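/- Let $n \ge 1$, $p > 1 + \frac{2}{n}$, and let $f \colon \mathbb{R} \to \mathbb{R}$ satisfy $f(0) = 0$ and, for some $K > 0$, $$|f(\xi) - f(\eta)| \le K \left( |\xi|^{p-1} + |\eta|^{p-1} \right) |\xi - \eta| \qquad (\xi, \eta \in \mathbb{R}).$$ For $t > 0$ let $G_t(x) = (4 \pi t)^{-n/2} e^{-|x|^2/(4t)}$ on $\mathbb{R}^n$, let $e^{t\Delta} \psi = G_t * \psi$ and $e^{0 \Delta} \psi = \psi$, and let $(\delta_t \psi)(x) = t^{-n/2} \psi(t^{-1/2} x)$. Let $L^1_k(\mathbb{R}^n)$ be the space of $\psi \in L^1(\mathbb{R}^n)$ with $x^\alpha \psi \in L^1(\mathbb{R}^n)$ for all multi-indices $|\alpha| \le k$. Put $$X = (C \cap L^\infty)([0,\infty); L^1(\mathbb{R}^n)) \cap (C \cap L^\infty)((0,\infty); L^\infty(\mathbb{R}^n)).$$ A global solution in $X$ of the Cauchy problem $\partial_t u - \Delta u = f(u)$, $u(0) = \varphi$, is a $u \in X$ with $$u(t) = e^{t \Delta} \varphi + \int_0^t e^{(t-s) \Delta} f(u(s))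 \, ds \qquad \text{for all } t \ge 0.$$ Then there is $\varepsilon_0 > 0$ such that the following hold. (a) For every $\varphi \in L^1 \cap L^\infty$ with $\|\varphi\|_1 + \|\varphi\|_\infty \le \varepsilon_0$ there is a unique global solution $u \in X$, and $\sup_{q \in [1,\infty]} \sup_{t \ge 0} (1+t)^{\frac{n}{2}(1 - \frac{1}{q})} \|u(t)\|_q < \infty$. (b) Let $m \in \{0, 1\}$, suppose moreover that $p > 1 + \frac{3+m}{n}$, and let $\varphi \in L^1_{m+1} \cap L^\infty$ satisfy $\|\varphi\|_1 + \|\varphi\|_\infty \le \varepsilon_0$, with global solution $u \in X$. Then $$\varphi_1 = \varphi + \int_0^\infty f(u(s)) \, ds, \qquad c_0 = \int_{\mathbb{R}^n} \varphi_1(y) \, dy, \qquad c_j = \int_{\mathbb{R}^n} y_j \varphi_1(y) \, dy \quad (1 \le j \le n)$$ are well defined (the first integral converges absolutely in $L^1(\mathbb{R}^n)$, and $\varphi_1$ and all $y_j \varphi_1$ are integrable), and for every $q \in [1, \infty]$ there is $C_q > 0$ such that for all $t > 1$ $$t^{\frac{n}{2}(1 - \frac{1}{q})} \left\| u(t) -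 c_0 \delta_t G_1 \right\|_q \le C_q t^{-1/2} \qquad \text{if } m = 0,$$ $$t^{\frac{n}{2}(1 - \frac{1}{q})} \left\| u(t) - c_0 \delta_t G_1 - \tfrac{1}{2} t^{-1/2} \sum_{j=1}^n c_j \, \delta_t (x_j G_1) \right\|_q \le C_q t^{-1} \qquad \text{if } m = 1.$$ -/

import Mathlib

open MeasureTheory Set
open scoped ENNReal Convolution

noncomputable section

namespace SemilinearHeat

/-- The space `ℝⁿ` with its Euclidean norm. -/
abbrev Rn (n : ℕ) : Type := EuclideanSpace ℝ (Fin n)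

/-- The Lebesgue space `L¹(ℝⁿ)` of real-valued functions. -/
abbrev L1 (n : ℕ) : Type := Lp ℝ 1 (volume : Measure (Rn n))

/-- The Lebesgue space `L^∞(ℝⁿ)` of real-valued functions. -/
abbrev LInf (n : ℕ) : Type := Lp ℝ ∞ (volume : Measure (Rn n))

/-- The Gauss kernel `G_t(x) = (4πt)^{-n/2} exp(-|x|²/(4t))`. -/
def gaussKernel (n : ℕ) (t : ℝ) (x : Rn n) : ℝ :=
  (4 * Real.pi * t) ^ (-((n : ℝ) / 2)) * Real.exp (-(‖x‖ ^ 2 / (4 * t)))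

/-- The dilation `(δ_t ψ)(x) = t^{-n/2} ψ(t^{-1/2} x)`. -/
def dilation {n : ℕ} (t : ℝ) (ψ : Rn n → ℝ) (x : Rn n) : ℝ :=
  t ^ (-((n : ℝ) / 2)) * ψ (t ^ (-(1 / 2) : ℝ) • x)

/-- Membership in the weighted space `L¹_m(ℝⁿ)`:
`φ` and all `x^α φ` with `|α| ≤ m` are integrable. -/
def MemWeightedL1 {n : ℕ} (m : ℕ) (φ : Rn n → ℝ) : Prop :=
  Integrable φ ∧
    ∀ α : Fin n → ℕ, ∑ i, α i ≤ m → Integrable (fun x : Rn n => (∏ i, x i ^ α i) * φ x)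

theorem integrable_gaussKernel (n : ℕ) {t : ℝ} (ht : 0 < t) :
    Integrable (gaussKernel n t) := by
  have h := GaussianFourier.integrable_cexp_neg_mul_sq_norm_add (V := Rn n)
    (b := ((1 / (4 * t) : ℝ) : ℂ)) (by rw [Complex.ofReal_re]; positivity) 0 0
  have h2 := h.norm.const_mul ((4 * Real.pi * t) ^ (-((n : ℝ) / 2)))
  refine h2.congr (Filter.Eventually.of_forall fun x => ?_)
  have e : (-((1 / (4 * t) : ℝ) : ℂ) * (‖x‖ : ℂ) ^ 2 + 0 * ((inner ℝ (0 : Rn n) x : ℝ) : ℂ))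
      = ((-(‖x‖ ^ 2 / (4 * t)) : ℝ) : ℂ) := by
    push_cast
    ring
  simp only [gaussKernel]
  rw [e, Complex.norm_exp, Complex.ofReal_re]

theorem memLp_gaussKernel_convolution {n : ℕ} {t : ℝ} (ht : 0 < t) (φ : L1 n) :
    MemLp (gaussKernel n t ⋆[ContinuousLinearMap.mul ℝ ℝ, volume] (φ : Rn n → ℝ)) 1
      (volume : Measure (Rn n)) :=
  memLp_one_iff_integrable.2
    ((integrable_gaussKernel n ht).integrable_convolution (ContinuousLinearMap.mul ℝ ℝ)
      (L1.integrable_coeFn φ))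

/-- The heat semigroup on `L¹(ℝⁿ)`: `e^{tΔ} φ = G_t * φ` for `t > 0`, and `e^{0Δ} φ = φ`.
(Only `t ≥ 0` is used.) -/
def heat {n : ℕ} (t : ℝ) (φ : L1 n) : L1 n :=
  if ht : 0 < t then (memLp_gaussKernel_convolution ht φ).toLp _ else φ

open Classical in
/-- The function `f ∘ w`, as an element of `L¹(ℝⁿ)`. The default value `0` is taken only where
`f ∘ w` is not in `L¹`; this never happens for `w ∈ L¹ ∩ L^∞` when `f(0) = 0` and `f` is locally
Lipschitz. -/
def nonlin {n : ℕ} (f : ℝ → ℝ) (w : L1 n) : L1 n :=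
  if h : MemLp (fun x => f (w x)) 1 (volume : Measure (Rn n)) then h.toLp _ else 0

/-- Membership in
`X = (C ∩ L^∞)([0,∞); L¹(ℝⁿ)) ∩ (C ∩ L^∞)((0,∞); L^∞(ℝⁿ))`.
The values of `u` at negative times play no role. -/
structure MemX {n : ℕ} (u : ℝ → L1 n) : Prop where
  continuousOn_L1 : ContinuousOn u (Ici 0)
  bounded_L1 : ∃ M : ℝ, ∀ t, 0 ≤ t → ‖u t‖ ≤ M
  LInf_part : ∃ v : ℝ → LInf n,
    (∀ t, 0 < t → (v t : Rn n → ℝ) =ᵐ[volume] (u t : Rn n → ℝ)) ∧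
      ContinuousOn v (Ioi 0) ∧ ∃ M : ℝ, ∀ t, 0 < t → ‖v t‖ ≤ M

/-- `u` is a global solution in `X` of `∂ₜu - Δu = f(u)`, `u(0) = φ`, in the mild sense:
`u(t) = e^{tΔ} φ + ∫₀ᵗ e^{(t-s)Δ} f(u(s)) ds` for all `t ≥ 0`, the integral being a
Bochner integral in `L¹(ℝⁿ)`. -/
structure IsGlobalSolution {n : ℕ} (f : ℝ → ℝ) (φ : L1 n) (u : ℝ → L1 n) : Prop where
  memX : MemX u
  integrable : ∀ t, 0 ≤ t →
    IntervalIntegrable (fun s => heat (t - s) (nonlin f (u s))) volume 0 t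
  duhamel : ∀ t, 0 ≤ t →
    u t = heat t φ + ∫ s in (0 : ℝ)..t, heat (t - s) (nonlin f (u s))

/-- The exponent `(n/2)(1 - 1/q)`, where `1/∞ = 0`. -/
def decayExp (n : ℕ) (q : ℝ≥0∞) : ℝ := (n : ℝ) / 2 * (1 - (q⁻¹).toReal)

/-- `sup_{q ∈ [1,∞]} sup_{t ≥ 0} (1+t)^{(n/2)(1-1/q)} ‖u(t)‖_q < ∞`. -/
def HasDecay {n : ℕ} (u : ℝ → L1 n) : Prop :=
  (⨆ q ∈ Icc (1 : ℝ≥0∞) ∞, ⨆ t ∈ Ici (0 : ℝ),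
    ENNReal.ofReal ((1 + t) ^ decayExp n q) * eLpNorm (u t : Rn n → ℝ) q volume) < ∞

/-- `φ₁ = φ + ∫₀^∞ f(u(s)) ds`, a Bochner integral in `L¹(ℝⁿ)`. -/
def phi1 {n : ℕ} (f : ℝ → ℝ) (φ : L1 n) (u : ℝ → L1 n) : L1 n :=
  φ + ∫ s in Ioi (0 : ℝ), nonlin f (u s)

/-- The zeroth moment `∫ ψ(y) dy`. -/
def moment0 {n : ℕ} (ψ : Rn n → ℝ) : ℝ := ∫ y, ψ y

/-- The first moment `∫ y_j ψ(y) dy`. -/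
def moment1 {n : ℕ} (j : Fin n) (ψ : Rn n → ℝ) : ℝ := ∫ y : Rn n, y j * ψ y

/-- The profile `c₀ δ_t G₁`, with `c₀` the zeroth moment of `ψ`. -/
def profile0 {n : ℕ} (ψ : Rn n → ℝ) (t : ℝ) (x : Rn n) : ℝ :=
  moment0 ψ * dilation t (gaussKernel n 1) x

/-- The profile `c₀ δ_t G₁ + ½ t^{-1/2} ∑_j c_j δ_t(x_j G₁)`, with `c₀`, `c_j` the zeroth and
first moments of `ψ`. -/
def profile1 {n : ℕ} (ψ : Rn n → ℝ) (t : ℝ) (x : Rn n) : ℝ :=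
  profile0 ψ t x + 1 / 2 * t ^ (-(1 / 2) : ℝ) *
    ∑ j : Fin n, moment1 j ψ * dilation t (fun z : Rn n => z j * gaussKernel n 1 z) x

end SemilinearHeat

end

namespace SemilinearHeat

variable {n : ℕ}

theorem gaussKernel_nonneg {t : ℝ} (ht : 0 < t) (x : Rn n) : 0 ≤ gaussKernel n t x := by
  unfold gaussKernel; positivity

theorem continuous_gaussKernel (t : ℝ) : Continuous (gaussKernel n t) := by
  unfold gaussKernel; fun_prop

theorem gaussKernel_le {t : ℝ} (ht : 0 < t) (x : Rn n) :
    gaussKernel n t x ≤ (4 * Real.pi * t) ^ (-((n : ℝ) / 2)) := by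
  unfold gaussKernel
  refine mul_le_of_le_one_right (by positivity) (Real.exp_le_one_iff.2 ?_)
  have : 0 ≤ ‖x‖ ^ 2 / (4 * t) := by positivity
  linarith

theorem integral_gaussKernel {t : ℝ} (ht : 0 < t) : ∫ x, gaussKernel n t x = 1 := by
  have hb : 0 < 1 / (4 * t) := by positivity
  have h := GaussianFourier.integral_rexp_neg_mul_sq_norm (V := Rn n) hb
  have e : gaussKernel n t = fun x => (4 * Real.pi * t) ^ (-((n : ℝ) / 2)) *
      Real.exp (-(1 / (4 * t)) * ‖x‖ ^ 2) := by
    funext x; simp only [gaussKernel]; congr 2; ring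
  rw [e, integral_const_mul, h, finrank_euclideanSpace_fin]
  have : Real.pi / (1 / (4 * t)) = 4 * Real.pi * t := by field_simp
  rw [this, ← Real.rpow_add (by positivity)]
  simp

theorem gaussKernel_convolution_gaussKernel {a b : ℝ} (ha : 0 < a) (hb : 0 < b) :
    gaussKernel n a ⋆[ContinuousLinearMap.mul ℝ ℝ, volume] gaussKernel n b =
      gaussKernel n (a + b) := by
  funext x
  have hab : 0 < a + b := by positivity
  set c : ℝ := a * b / (a + b) with hc
  have hc0 : 0 < c := by positivity
  have key : ∀ y : Rn n, gaussKernel n a y * gaussKernel n b (x - y) =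
      gaussKernel n (a + b) x * gaussKernel n c (y - (a / (a + b)) • x) := by
    intro y
    simp only [gaussKernel]
    have e1 : (4 * Real.pi * a) ^ (-((n : ℝ) / 2)) * (4 * Real.pi * b) ^ (-((n : ℝ) / 2)) =
        (4 * Real.pi * (a + b)) ^ (-((n : ℝ) / 2)) * (4 * Real.pi * c) ^ (-((n : ℝ) / 2)) := by
      rw [← Real.mul_rpow (by positivity) (by positivity),
        ← Real.mul_rpow (by positivity) (by positivity)]
      congr 1
      rw [hc]; field_simp
    have e2 : -(‖y‖ ^ 2 / (4 * a)) + -(‖x - y‖ ^ 2 / (4 * b)) =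
        -(‖x‖ ^ 2 / (4 * (a + b))) + -(‖y - (a / (a + b)) • x‖ ^ 2 / (4 * c)) := by
      rw [norm_sub_sq_real, norm_sub_sq_real, norm_smul, real_inner_smul_right,
        real_inner_comm x y, hc, Real.norm_of_nonneg (by positivity)]
      field_simp
      ring
    calc _ = ((4 * Real.pi * a) ^ (-((n : ℝ) / 2)) * (4 * Real.pi * b) ^ (-((n : ℝ) / 2))) *
          Real.exp (-(‖y‖ ^ 2 / (4 * a)) + -(‖x - y‖ ^ 2 / (4 * b))) := by
            rw [Real.exp_add]; ring
      _ = _ := by rw [e1, e2, Real.exp_add]; ring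
  rw [convolution_mul]
  simp_rw [key]
  rw [integral_const_mul, integral_sub_right_eq_self (fun y => gaussKernel n c y),
    integral_gaussKernel hc0, mul_one]

/-- The loss in the bound of a Gaussian times a quadratic polynomial by a wider Gaussian. -/
noncomputable def domConst (n : ℕ) : ℝ := 8 * 2 ^ ((n : ℝ) / 2)

theorem one_le_domConst (n : ℕ) : 1 ≤ domConst n := by
  have : (1 : ℝ) ≤ 2 ^ ((n : ℝ) / 2) := Real.one_le_rpow (by norm_num) (by positivity)
  unfold domConst; linarith

theorem quadratic_mul_gaussKernel_le {t : ℝ} (ht : 0 < t) (x : Rn n) :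
    (1 + ‖x‖ ^ 2 / t) * gaussKernel n t x ≤ domConst n * gaussKernel n (2 * t) x := by
  set s := ‖x‖ ^ 2 / t with hs
  have hs0 : 0 ≤ s := by positivity
  have e1 : 1 + s ≤ 8 * Real.exp (s / 8) := by
    have := Real.add_one_le_exp (s / 8); linarith
  have e2 : (4 * Real.pi * (2 * t)) ^ (-((n : ℝ) / 2)) =
      2 ^ (-((n : ℝ) / 2)) * (4 * Real.pi * t) ^ (-((n : ℝ) / 2)) := by
    rw [← Real.mul_rpow (by positivity) (by positivity)]; congr 1; ring
  have e3 : ‖x‖ ^ 2 / (4 * t) = s / 4 := by rw [hs]; field_simp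
  have e4 : ‖x‖ ^ 2 / (4 * (2 * t)) = s / 8 := by rw [hs]; field_simp; ring
  have e5 : (2 : ℝ) ^ ((n : ℝ) / 2) * 2 ^ (-((n : ℝ) / 2)) = 1 := by
    rw [← Real.rpow_add (by norm_num)]; simp
  have e6 : Real.exp (s / 8) * Real.exp (-(s / 4)) = Real.exp (-(s / 8)) := by
    rw [← Real.exp_add]; congr 1; ring
  simp only [gaussKernel, domConst]
  rw [e2, e3, e4, ← e6]
  calc (1 + s) * ((4 * Real.pi * t) ^ (-((n : ℝ) / 2)) * Real.exp (-(s / 4)))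
      ≤ (8 * Real.exp (s / 8)) * ((4 * Real.pi * t) ^ (-((n : ℝ) / 2)) * Real.exp (-(s / 4))) := by
        gcongr
    _ = 8 * (2 ^ ((n : ℝ) / 2) * 2 ^ (-((n : ℝ) / 2))) * (4 * Real.pi * t) ^ (-((n : ℝ) / 2)) *
          (Real.exp (s / 8) * Real.exp (-(s / 4))) := by rw [e5]; ring
    _ = _ := by ring

theorem gaussKernel_le_domConst_mul {t : ℝ} (ht : 0 < t) (x : Rn n) :
    gaussKernel n t x ≤ domConst n * gaussKernel n (2 * t) x := by
  refine le_trans ?_ (quadratic_mul_gaussKernel_le ht x)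
  refine le_mul_of_one_le_left (gaussKernel_nonneg ht x) ?_
  have : 0 ≤ ‖x‖ ^ 2 / t := by positivity
  linarith

theorem pow_sub_one_le {r : ℝ} (h1 : 1 ≤ r) (h2 : r ≤ 2) (k : ℕ) :
    r ^ k - 1 ≤ (2 ^ k - 1) * (r - 1) := by
  induction k with
  | zero => simp
  | succ k ih =>
    have h3 : r * (r ^ k - 1) ≤ 2 * ((2 ^ k - 1) * (r - 1)) :=
      mul_le_mul h2 ih (by have := one_le_pow₀ (n := k) h1; linarith) (by norm_num)
    calc r ^ (k + 1) - 1 = r * (r ^ k - 1) + (r - 1) := by ring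
      _ ≤ 2 * ((2 ^ k - 1) * (r - 1)) + (r - 1) := by linarith
      _ = _ := by ring

/-- Lipschitz dependence of the Gauss kernel on time. -/
theorem abs_gaussKernel_time_sub_le {t τ : ℝ} (ht : 0 < t) (h1 : t / 2 ≤ τ) (h2 : τ ≤ t)
    (x : Rn n) :
    |gaussKernel n τ x - gaussKernel n t x| ≤
      2 ^ (n + 1) * domConst n * ((t - τ) / t) * gaussKernel n (2 * t) x := by
  have hτ : 0 < τ := by linarith
  set r := t / τ with hr
  have hr1 : 1 ≤ r := by rw [hr, one_le_div hτ]; exact h2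
  have hr2 : r ≤ 2 := by rw [hr, div_le_iff₀ hτ]; linarith
  set A := (4 * Real.pi * t) ^ (-((n : ℝ) / 2)) with hA
  have hA0 : 0 < A := by positivity
  have eA : (4 * Real.pi * τ) ^ (-((n : ℝ) / 2)) = A * r ^ ((n : ℝ) / 2) := by
    have : 4 * Real.pi * τ = 4 * Real.pi * t * r⁻¹ := by rw [hr]; field_simp
    rw [this, Real.mul_rpow (by positivity) (by positivity), Real.inv_rpow (by positivity),
      Real.rpow_neg (show 0 ≤ r by positivity), inv_inv]
  set E := Real.exp (-(‖x‖ ^ 2 / (4 * t))) with hE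
  set d := ‖x‖ ^ 2 / (4 * τ) - ‖x‖ ^ 2 / (4 * t) with hd
  have hE0 : 0 < E := Real.exp_pos _
  have hd0 : 0 ≤ d := by
    rw [hd, sub_nonneg]; gcongr
  have eE : Real.exp (-(‖x‖ ^ 2 / (4 * τ))) = E * Real.exp (-d) := by
    rw [hE, ← Real.exp_add, hd]; congr 1; ring
  have hst : 0 ≤ (t - τ) / t := div_nonneg (by linarith) ht.le
  have hrst : r - 1 ≤ 2 * ((t - τ) / t) := by
    have : r - 1 = r * ((t - τ) / t) := by rw [hr]; field_simp
    rw [this]; gcongr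
  have hrn : r ^ ((n : ℝ) / 2) - 1 ≤ 2 ^ (n + 1) * ((t - τ) / t) := by
    have a1 : r ^ ((n : ℝ) / 2) ≤ r ^ (n : ℝ) :=
      Real.rpow_le_rpow_of_exponent_le hr1 (by have : (0 : ℝ) ≤ n := by positivity
                                               linarith)
    rw [Real.rpow_natCast] at a1
    have a2 := pow_sub_one_le hr1 hr2 n
    have a3 : ((2 : ℝ) ^ n - 1) * (r - 1) ≤ 2 ^ n * (2 * ((t - τ) / t)) := by
      gcongr
      linarith
    calc _ ≤ r ^ n - 1 := by linarith
      _ ≤ _ := by rw [pow_succ]; linarith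
  have hrn0 : 1 ≤ r ^ ((n : ℝ) / 2) := Real.one_le_rpow hr1 (by positivity)
  have hdle : d ≤ (‖x‖ ^ 2 / t) * ((t - τ) / t) := by
    have : d = (‖x‖ ^ 2 / t) * ((t - τ) / t) * (r / 4) := by
      rw [hd, hr]; field_simp
    rw [this]
    refine mul_le_of_le_one_right (by positivity) (by linarith)
  have hexp : 1 - Real.exp (-d) ≤ d := by
    have := Real.add_one_le_exp (-d); linarith
  have hexp1 : Real.exp (-d) ≤ 1 := Real.exp_le_one_iff.2 (by linarith)
  have e : gaussKernel n τ x - gaussKernel n t x =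
      A * E * ((r ^ ((n : ℝ) / 2) - 1) * Real.exp (-d) - (1 - Real.exp (-d))) := by
    simp only [gaussKernel]; rw [eA, eE]; ring
  have h2n : (1 : ℝ) ≤ 2 ^ (n + 1) := one_le_pow₀ (by norm_num)
  have bound : |(r ^ ((n : ℝ) / 2) - 1) * Real.exp (-d) - (1 - Real.exp (-d))| ≤
      2 ^ (n + 1) * ((t - τ) / t) * (1 + ‖x‖ ^ 2 / t) := by
    have b1 : (r ^ ((n : ℝ) / 2) - 1) * Real.exp (-d) ≤ 2 ^ (n + 1) * ((t - τ) / t) :=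
      (mul_le_of_le_one_right (by linarith) hexp1).trans hrn
    have b0 : 0 ≤ (r ^ ((n : ℝ) / 2) - 1) * Real.exp (-d) :=
      mul_nonneg (by linarith) (Real.exp_pos _).le
    have b2 : 1 - Real.exp (-d) ≤ 2 ^ (n + 1) * ((t - τ) / t) * (‖x‖ ^ 2 / t) := by
      refine (hexp.trans hdle).trans ?_
      calc ‖x‖ ^ 2 / t * ((t - τ) / t) = 1 * (‖x‖ ^ 2 / t * ((t - τ) / t)) := by ring
        _ ≤ 2 ^ (n + 1) * (‖x‖ ^ 2 / t * ((t - τ) / t)) := by gcongr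
        _ = _ := by ring
    rw [abs_le]
    constructor <;> nlinarith
  calc |gaussKernel n τ x - gaussKernel n t x|
      = A * E * |(r ^ ((n : ℝ) / 2) - 1) * Real.exp (-d) - (1 - Real.exp (-d))| := by
        rw [e, abs_mul, abs_of_pos (mul_pos hA0 hE0)]
    _ ≤ A * E * (2 ^ (n + 1) * ((t - τ) / t) * (1 + ‖x‖ ^ 2 / t)) := by gcongr
    _ = 2 ^ (n + 1) * ((t - τ) / t) * ((1 + ‖x‖ ^ 2 / t) * gaussKernel n t x) := by
        simp only [gaussKernel]; ring
    _ ≤ 2 ^ (n + 1) * ((t - τ) / t) * (domConst n * gaussKernel n (2 * t) x) :=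
        mul_le_mul_of_nonneg_left (quadratic_mul_gaussKernel_le ht x) (by positivity)
    _ = _ := by ring

theorem exp_sub_one_sub_le_of_nonpos {a : ℝ} (ha : a ≤ 0) :
    Real.exp a - 1 - a ≤ min (a ^ 2) (-a) := by
  have h1 : Real.exp a ≤ 1 := Real.exp_le_one_iff.2 ha
  refine le_min ?_ (by linarith)
  by_cases h : -1 ≤ a
  · exact (le_abs_self _).trans (Real.abs_exp_sub_one_sub_id_le (abs_le.2 ⟨h, by linarith⟩))
  · nlinarith

theorem exp_sub_one_sub_le_of_nonneg {a : ℝ} (ha : 0 ≤ a) :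
    Real.exp a - 1 - a ≤ min (a ^ 2) a * Real.exp a := by
  have h1 : 1 ≤ Real.exp a := Real.one_le_exp ha
  have h2 : Real.exp a - 1 ≤ a * Real.exp a := by
    have := Real.add_one_le_exp (-a)
    have h3 : Real.exp (-a) * Real.exp a = 1 := by rw [← Real.exp_add]; simp
    nlinarith
  rcases le_total a 1 with h | h
  · rw [min_eq_left (by nlinarith)]
    have := (le_abs_self _).trans (Real.abs_exp_sub_one_sub_id_le (abs_le.2 ⟨by linarith, h⟩))
    nlinarith [sq_nonneg a]
  · rw [min_eq_right (by nlinarith)]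
    linarith

theorem min_sq_abs_le {a t : ℝ} (ht : 0 < t) {x y : Rn n}
    (ha : |a| ≤ (2 * ‖x‖ * ‖y‖ + ‖y‖ ^ 2) / (4 * t)) :
    min (a ^ 2) |a| ≤ ‖y‖ ^ 2 / t * (1 + ‖x‖ ^ 2 / t) := by
  have hx := norm_nonneg x
  have hy := norm_nonneg y
  rcases le_total ‖y‖ ‖x‖ with h | h
  · refine (min_le_left _ _).trans ?_
    have h1 : |a| ≤ ‖x‖ * ‖y‖ / t := by
      refine ha.trans ?_
      rw [div_le_div_iff₀ (by positivity) ht]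
      nlinarith [mul_nonneg hx hy, mul_le_mul_of_nonneg_right h hy,
        mul_le_mul_of_nonneg_left (mul_le_mul_of_nonneg_right h hy) ht.le,
        mul_nonneg ht.le (mul_nonneg hx hy)]
    have h2 : a ^ 2 ≤ (‖x‖ * ‖y‖ / t) ^ 2 := by
      rw [← sq_abs a]; gcongr
    have h3 : (‖x‖ * ‖y‖ / t) ^ 2 = ‖y‖ ^ 2 / t * (‖x‖ ^ 2 / t) := by field_simp
    have h4 : 0 ≤ ‖y‖ ^ 2 / t := by positivity
    nlinarith
  · refine (min_le_right _ _).trans ?_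
    have h1 : |a| ≤ ‖y‖ ^ 2 / t := by
      refine ha.trans ?_
      rw [div_le_div_iff₀ (by positivity) ht]
      nlinarith [mul_le_mul_of_nonneg_right h hy,
        mul_le_mul_of_nonneg_left (mul_le_mul_of_nonneg_right h hy) ht.le,
        mul_nonneg ht.le (mul_nonneg hy hy)]
    have h4 : 0 ≤ ‖y‖ ^ 2 / t * (‖x‖ ^ 2 / t) := by positivity
    linarith

/-- Second order Taylor expansion of the Gauss kernel in space. -/
theorem abs_gaussKernel_sub_taylor_one_le {t : ℝ} (ht : 0 < t) (x y : Rn n) :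
    |gaussKernel n t (x - y) - gaussKernel n t x - inner ℝ x y / (2 * t) * gaussKernel n t x| ≤
      2 * domConst n * (‖y‖ ^ 2 / t) * (gaussKernel n (2 * t) (x - y) + gaussKernel n (2 * t) x) := by
  set a := (2 * inner ℝ x y - ‖y‖ ^ 2) / (4 * t) with ha
  have hG : gaussKernel n t (x - y) = gaussKernel n t x * Real.exp a := by
    simp only [gaussKernel]
    rw [mul_assoc ((4 * Real.pi * t) ^ (-((n : ℝ) / 2))), ← Real.exp_add, norm_sub_sq_real, ha]
    congr 2; field_simp; ring
  have hin : inner ℝ x y / (2 * t) = a + ‖y‖ ^ 2 / (4 * t) := by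
    rw [ha]; field_simp; ring
  have hGx := gaussKernel_nonneg ht x
  have hGz := gaussKernel_nonneg ht (x - y)
  have hQ : 0 ≤ ‖y‖ ^ 2 / t := by positivity
  have hqx := quadratic_mul_gaussKernel_le ht x
  have hqz := quadratic_mul_gaussKernel_le ht (x - y)
  have hlow : 0 ≤ Real.exp a - 1 - a := by have := Real.add_one_le_exp a; linarith
  have h2x : 0 ≤ gaussKernel n (2 * t) x := gaussKernel_nonneg (by positivity) x
  have h2z : 0 ≤ gaussKernel n (2 * t) (x - y) := gaussKernel_nonneg (by positivity) _
  have hD := one_le_domConst n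
  have main : gaussKernel n t x * (Real.exp a - 1 - a) ≤
      domConst n * (‖y‖ ^ 2 / t) *
        (gaussKernel n (2 * t) (x - y) + gaussKernel n (2 * t) x) := by
    rcases le_total a 0 with h0 | h0
    · have h1 : |a| ≤ (2 * ‖x‖ * ‖y‖ + ‖y‖ ^ 2) / (4 * t) := by
        rw [ha, abs_div, abs_of_pos (by positivity : 0 < 4 * t)]
        gcongr
        have := abs_real_inner_le_norm x y
        rw [abs_le] at this ⊢
        constructor <;> nlinarith [sq_nonneg ‖y‖]
      have h2 := exp_sub_one_sub_le_of_nonpos h0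
      rw [← abs_of_nonpos h0] at h2
      have h3 := h2.trans (min_sq_abs_le ht h1)
      calc _ ≤ gaussKernel n t x * (‖y‖ ^ 2 / t * (1 + ‖x‖ ^ 2 / t)) := by gcongr
        _ = ‖y‖ ^ 2 / t * ((1 + ‖x‖ ^ 2 / t) * gaussKernel n t x) := by ring
        _ ≤ ‖y‖ ^ 2 / t * (domConst n * gaussKernel n (2 * t) x) := by gcongr
        _ ≤ _ := by
          have : 0 ≤ domConst n * (‖y‖ ^ 2 / t) * gaussKernel n (2 * t) (x - y) := by positivity
          linarith
    · have haz : a = (2 * inner ℝ (x - y) y + ‖y‖ ^ 2) / (4 * t) := by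
        rw [ha, inner_sub_left, real_inner_self_eq_norm_sq]; congr 1; ring
      have h1 : |a| ≤ (2 * ‖x - y‖ * ‖y‖ + ‖y‖ ^ 2) / (4 * t) := by
        rw [haz, abs_div, abs_of_pos (by positivity : 0 < 4 * t)]
        gcongr
        have := abs_real_inner_le_norm (x - y) y
        rw [abs_le] at this ⊢
        constructor <;> nlinarith [sq_nonneg ‖y‖]
      have h2 := exp_sub_one_sub_le_of_nonneg h0
      have h3 := min_sq_abs_le ht h1
      rw [abs_of_nonneg h0] at h3
      calc _ ≤ gaussKernel n t x * (min (a ^ 2) a * Real.exp a) := by gcongr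
        _ = min (a ^ 2) a * gaussKernel n t (x - y) := by rw [hG]; ring
        _ ≤ ‖y‖ ^ 2 / t * (1 + ‖x - y‖ ^ 2 / t) * gaussKernel n t (x - y) := by gcongr
        _ = ‖y‖ ^ 2 / t * ((1 + ‖x - y‖ ^ 2 / t) * gaussKernel n t (x - y)) := by ring
        _ ≤ ‖y‖ ^ 2 / t * (domConst n * gaussKernel n (2 * t) (x - y)) := by gcongr
        _ ≤ _ := by
          have : 0 ≤ domConst n * (‖y‖ ^ 2 / t) * gaussKernel n (2 * t) x := by positivity
          linarith
  have hsmall : ‖y‖ ^ 2 / (4 * t) * gaussKernel n t x ≤ domConst n * (‖y‖ ^ 2 / t) *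
        (gaussKernel n (2 * t) (x - y) + gaussKernel n (2 * t) x) := by
    have h1 : ‖y‖ ^ 2 / (4 * t) ≤ ‖y‖ ^ 2 / t := by gcongr; linarith
    calc _ ≤ ‖y‖ ^ 2 / t * (domConst n * gaussKernel n (2 * t) x) := by
            gcongr; exact gaussKernel_le_domConst_mul ht x
      _ ≤ _ := by
          have : 0 ≤ domConst n * (‖y‖ ^ 2 / t) * gaussKernel n (2 * t) (x - y) := by positivity
          linarith
  have e : gaussKernel n t (x - y) - gaussKernel n t x -
      inner ℝ x y / (2 * t) * gaussKernel n t x =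
      gaussKernel n t x * (Real.exp a - 1 - a) - ‖y‖ ^ 2 / (4 * t) * gaussKernel n t x := by
    rw [hG, hin]; ring
  have p1 : 0 ≤ gaussKernel n t x * (Real.exp a - 1 - a) := mul_nonneg hGx hlow
  have p2 : 0 ≤ ‖y‖ ^ 2 / (4 * t) * gaussKernel n t x := by positivity
  rw [e, abs_le]
  constructor <;> linarith

/-- First order Taylor expansion of the Gauss kernel in space. -/
theorem abs_gaussKernel_sub_taylor_zero_le {t : ℝ} (ht : 0 < t) (x y : Rn n) :
    |gaussKernel n t (x - y) - gaussKernel n t x| ≤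
      3 * domConst n * (‖y‖ / √t) *
        (gaussKernel n (2 * t) (x - y) + gaussKernel n (2 * t) x) := by
  have hD := one_le_domConst n
  have h2x : 0 ≤ gaussKernel n (2 * t) x := gaussKernel_nonneg (by positivity) x
  have h2z : 0 ≤ gaussKernel n (2 * t) (x - y) := gaussKernel_nonneg (by positivity) _
  have hGx := gaussKernel_nonneg ht x
  have hGz := gaussKernel_nonneg ht (x - y)
  have hst : 0 < √t := Real.sqrt_pos.2 ht
  set S := gaussKernel n (2 * t) (x - y) + gaussKernel n (2 * t) x with hS
  have hS0 : 0 ≤ S := by positivity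
  rcases le_total ‖y‖ √t with h | h
  · have hq : ‖y‖ ^ 2 / t ≤ ‖y‖ / √t := by
      have : ‖y‖ ^ 2 / t = ‖y‖ / √t * (‖y‖ / √t) := by
        field_simp; rw [Real.sq_sqrt ht.le]
      rw [this]
      exact mul_le_of_le_one_right (by positivity) ((div_le_one hst).2 h)
    have h1 := abs_gaussKernel_sub_taylor_one_le ht x y
    have h2 : |inner ℝ x y / (2 * t) * gaussKernel n t x| ≤ domConst n * (‖y‖ / √t) * S := by
      rw [abs_mul, abs_of_nonneg hGx, abs_div, abs_of_pos (by positivity : 0 < 2 * t)]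
      have h3 : |inner ℝ x y| / (2 * t) ≤ ‖y‖ / √t * (1 + ‖x‖ ^ 2 / t) := by
        have h4 : |inner ℝ x y| / (2 * t) ≤ ‖x‖ * ‖y‖ / (2 * t) := by
          gcongr; exact abs_real_inner_le_norm x y
        refine h4.trans ?_
        have h5 : ‖x‖ * ‖y‖ / (2 * t) = ‖y‖ / √t * ((‖x‖ / √t) / 2) := by
          field_simp; rw [Real.sq_sqrt ht.le]
        have h6 : ‖x‖ ^ 2 / t = (‖x‖ / √t) ^ 2 := by rw [div_pow, Real.sq_sqrt ht.le]
        rw [h5, h6]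
        gcongr
        nlinarith [sq_nonneg (‖x‖ / √t - 1), sq_nonneg (‖x‖ / √t)]
      calc _ ≤ ‖y‖ / √t * (1 + ‖x‖ ^ 2 / t) * gaussKernel n t x := by gcongr
        _ = ‖y‖ / √t * ((1 + ‖x‖ ^ 2 / t) * gaussKernel n t x) := by ring
        _ ≤ ‖y‖ / √t * (domConst n * gaussKernel n (2 * t) x) :=
          mul_le_mul_of_nonneg_left (quadratic_mul_gaussKernel_le ht x) (by positivity)
        _ ≤ ‖y‖ / √t * (domConst n * S) := by gcongr; linarith
        _ = _ := by ring
    calc _ = |(gaussKernel n t (x - y) - gaussKernel n t x -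
          inner ℝ x y / (2 * t) * gaussKernel n t x) +
          inner ℝ x y / (2 * t) * gaussKernel n t x| := by congr 1; ring
      _ ≤ _ := abs_add_le _ _
      _ ≤ 2 * domConst n * (‖y‖ ^ 2 / t) * S + domConst n * (‖y‖ / √t) * S := add_le_add h1 h2
      _ ≤ 2 * domConst n * (‖y‖ / √t) * S + domConst n * (‖y‖ / √t) * S := by gcongr
      _ = _ := by ring
  · have h1 : 1 ≤ ‖y‖ / √t := (one_le_div hst).2 h
    have a1 := gaussKernel_le_domConst_mul ht x
    have a2 := gaussKernel_le_domConst_mul ht (x - y)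
    have a3 : |gaussKernel n t (x - y) - gaussKernel n t x| ≤ domConst n * S := by
      rw [abs_le]; constructor <;> rw [hS] <;> nlinarith
    have a4 : domConst n * S ≤ domConst n * S * (‖y‖ / √t) :=
      le_mul_of_one_le_right (by positivity) h1
    have a5 : 0 ≤ domConst n * (‖y‖ / √t) * S := by positivity
    linarith

/-- `|w| ≤ c` almost everywhere. -/
def BddAE (c : ℝ) (w : L1 n) : Prop := ∀ᵐ x, |w x| ≤ c

theorem BddAE.mono {c d : ℝ} {w : L1 n} (h : BddAE c w) (hcd : c ≤ d) : BddAE d w :=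
  Filter.Eventually.mono h fun _ hx => hx.trans hcd

theorem BddAE.add {c d : ℝ} {w v : L1 n} (hw : BddAE c w) (hv : BddAE d v) :
    BddAE (c + d) (w + v) := by
  filter_upwards [hw, hv, Lp.coeFn_add w v] with x h1 h2 h3
  rw [h3, Pi.add_apply]
  exact (abs_add_le _ _).trans (add_le_add h1 h2)

theorem BddAE.neg {c : ℝ} {w : L1 n} (hw : BddAE c w) : BddAE c (-w) := by
  filter_upwards [hw, Lp.coeFn_neg w] with x h1 h3
  rwa [h3, Pi.neg_apply, abs_neg]

theorem BddAE.sub {c d : ℝ} {w v : L1 n} (hw : BddAE c w) (hv : BddAE d v) :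
    BddAE (c + d) (w - v) := sub_eq_add_neg w v ▸ hw.add hv.neg

theorem ae_le_of_setIntegral_le_const {c : ℝ} {w : L1 n}
    (h : ∀ A : Set (Rn n), MeasurableSet A → volume A < ∞ → ∫ x in A, w x ≤ c * volume.real A) :
    ∀ᵐ x, w x ≤ c := by
  have := ae_nonneg_of_forall_setIntegral_nonneg_of_sigmaFinite (μ := (volume : Measure (Rn n)))
    (f := fun x => c - w x) ?_ ?_
  · filter_upwards [this] with x hx
    simpa using hx
  · intro s hs hs'
    exact (integrableOn_const hs'.ne).sub (L1.integrable_coeFn w).integrableOn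
  · intro s hs hs'
    have hc : IntegrableOn (fun _ : Rn n => c) s := integrableOn_const hs'.ne
    rw [integral_sub hc (L1.integrable_coeFn w).integrableOn, setIntegral_const, smul_eq_mul]
    linarith [h s hs hs', mul_comm c (volume.real s)]

theorem bddAE_iff_setIntegral {c : ℝ} {w : L1 n} :
    BddAE c w ↔ ∀ A : Set (Rn n), MeasurableSet A → volume A < ∞ →
      |∫ x in A, w x| ≤ c * volume.real A := by
  constructor
  · intro h A hA hA'
    rw [← Real.norm_eq_abs]
    refine norm_setIntegral_le_of_norm_le_const_ae hA' ?_
    exact ae_restrict_of_ae h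
  · intro h
    have h1 := ae_le_of_setIntegral_le_const (c := c) (w := w)
      fun A hA hA' => (le_abs_self _).trans (h A hA hA')
    have h2 := ae_le_of_setIntegral_le_const (c := c) (w := -w) fun A hA hA' => by
      rw [setIntegral_congr_ae (g := fun x => -w x) hA
        ((Lp.coeFn_neg w).mono fun x hx _ => hx), integral_neg]
      exact (neg_le_abs _).trans (h A hA hA')
    filter_upwards [h1, h2, Lp.coeFn_neg w] with x h1 h2 h3
    rw [h3, Pi.neg_apply] at h2
    exact abs_le.2 ⟨by linarith, h1⟩

theorem isClosed_bddAE (c : ℝ) : IsClosed {w : L1 n | BddAE c w} := by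
  simp only [bddAE_iff_setIntegral, ofPred_forall]
  refine isClosed_iInter fun A => isClosed_iInter fun _ => isClosed_iInter fun _ => ?_
  exact isClosed_le (continuous_setIntegral A).abs continuous_const

/-- Restriction to `A` followed by integration, as a functional on `L¹`. -/
noncomputable def setIntegralCLM (A : Set (Rn n)) : L1 n →L[ℝ] ℝ :=
  LinearMap.mkContinuous
    { toFun := fun w => ∫ x in A, w x
      map_add' := fun w v => by
        rw [integral_congr_ae (ae_restrict_of_ae (Lp.coeFn_add w v))]
        exact integral_add (L1.integrable_coeFn w).integrableOn (L1.integrable_coeFn v).integrableOn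
      map_smul' := fun r w => by
        rw [integral_congr_ae (ae_restrict_of_ae (Lp.coeFn_smul r w))]
        exact integral_const_mul r _ } 1 fun w => by
    rw [one_mul, L1.norm_eq_integral_norm]
    exact (norm_integral_le_integral_norm _).trans
      (setIntegral_le_integral (L1.integrable_coeFn w).norm (ae_of_all _ fun _ => norm_nonneg _))

theorem BddAE.integral {μ : Measure ℝ} {F : ℝ → L1 n} {g : ℝ → ℝ} (hF : Integrable F μ)
    (hg : Integrable g μ) (h : ∀ᵐ s ∂μ, BddAE (g s) (F s)) :
    BddAE (∫ s, g s ∂μ) (∫ s, F s ∂μ) := by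
  rw [bddAE_iff_setIntegral]
  intro A hA hA'
  have e : ∫ x in A, (∫ s, F s ∂μ : L1 n) x = ∫ s, (∫ x in A, F s x) ∂μ :=
    ((setIntegralCLM A).integral_comp_comm hF).symm
  rw [e, ← Real.norm_eq_abs, ← integral_mul_const]
  refine norm_integral_le_of_norm_le (hg.mul_const _) ?_
  filter_upwards [h] with s hs
  exact bddAE_iff_setIntegral.1 hs A hA hA'

theorem memLp_weight_mul {W : Rn n → ℝ} (hW : Continuous W) {R : ℝ} (hR : ∀ x, |W x| ≤ R)
    (w : L1 n) : MemLp (fun x => W x * w x) 1 volume :=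
  memLp_one_iff_integrable.2
    ((L1.integrable_coeFn w).bdd_mul hW.aestronglyMeasurable (ae_of_all _ hR))

/-- Multiplication by a bounded continuous weight on `L¹`. -/
noncomputable def weightMul {W : Rn n → ℝ} (hW : Continuous W) {R : ℝ} (hR : ∀ x, |W x| ≤ R) :
    L1 n →L[ℝ] L1 n :=
  LinearMap.mkContinuous
    { toFun := fun w => (memLp_weight_mul hW hR w).toLp _
      map_add' := fun w v => by
        rw [← MemLp.toLp_add]
        refine MemLp.toLp_congr _ _ ?_
        filter_upwards [Lp.coeFn_add w v] with x hx
        rw [hx]; simp only [Pi.add_apply]; ring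
      map_smul' := fun r w => by
        rw [RingHom.id_apply, ← MemLp.toLp_const_smul]
        refine MemLp.toLp_congr _ _ ?_
        filter_upwards [Lp.coeFn_smul r w] with x hx
        rw [hx]; simp only [Pi.smul_apply, smul_eq_mul]; ring } R fun w => by
    rw [L1.norm_eq_integral_norm, L1.norm_eq_integral_norm, ← integral_const_mul]
    refine integral_mono_ae (L1.integrable_coeFn _).norm
      ((L1.integrable_coeFn w).norm.const_mul R) ?_
    filter_upwards [MemLp.coeFn_toLp (memLp_weight_mul hW hR w)] with x hx
    simp only [LinearMap.coe_mk, AddHom.coe_mk]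
    rw [hx, norm_mul]
    exact mul_le_mul_of_nonneg_right (hR x) (norm_nonneg _)

theorem norm_weightMul {W : Rn n → ℝ} (hW : Continuous W) {R : ℝ} (hR : ∀ x, |W x| ≤ R)
    (w : L1 n) : ‖weightMul hW hR w‖ = ∫ x, |W x| * |w x| := by
  rw [L1.norm_eq_integral_norm]
  refine integral_congr_ae ?_
  filter_upwards [MemLp.coeFn_toLp (memLp_weight_mul hW hR w)] with x hx
  change ‖((memLp_weight_mul hW hR w).toLp _ : L1 n) x‖ = _
  rw [hx, norm_mul]; rfl

/-- The Gaussian average of a function. -/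
noncomputable def gaussConv (t : ℝ) (h : Rn n → ℝ) (x : Rn n) : ℝ :=
  ∫ y, gaussKernel n t (x - y) * h y

theorem convolution_gaussKernel_eq (t : ℝ) (h : Rn n → ℝ) :
    gaussKernel n t ⋆[ContinuousLinearMap.mul ℝ ℝ, volume] h = gaussConv t h := by
  funext x; exact convolution_mul_swap

theorem gaussConv_congr {t : ℝ} {h g : Rn n → ℝ} (e : h =ᵐ[volume] g) :
    gaussConv t h = gaussConv t g := by
  funext x
  exact integral_congr_ae (e.mono fun y hy => by simp only [hy])

theorem integrable_gaussKernel_mul {t : ℝ} (ht : 0 < t) {h : Rn n → ℝ} (hh : Integrable h)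
    (x : Rn n) : Integrable fun y => gaussKernel n t (x - y) * h y := by
  refine hh.bdd_mul (c := (4 * Real.pi * t) ^ (-((n : ℝ) / 2)))
    ((continuous_gaussKernel t).comp (by fun_prop)).aestronglyMeasurable (ae_of_all _ fun y => ?_)
  rw [Real.norm_of_nonneg (gaussKernel_nonneg ht _)]
  exact gaussKernel_le ht _

theorem integrable_gaussConv {t : ℝ} (ht : 0 < t) {h : Rn n → ℝ} (hh : Integrable h) :
    Integrable (gaussConv t h) := by
  rw [← convolution_gaussKernel_eq]
  exact (integrable_gaussKernel n ht).integrable_convolution (ContinuousLinearMap.mul ℝ ℝ) hh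

theorem integral_gaussConv {t : ℝ} (ht : 0 < t) {h : Rn n → ℝ} (hh : Integrable h) :
    ∫ x, gaussConv t h x = ∫ x, h x := by
  rw [← convolution_gaussKernel_eq, integral_convolution _ (integrable_gaussKernel n ht) hh,
    integral_gaussKernel ht]
  simp

theorem gaussConv_le {t : ℝ} (ht : 0 < t) {h : Rn n → ℝ} (hh : Integrable h) (h0 : ∀ x, 0 ≤ h x)
    (x : Rn n) : gaussConv t h x ≤ (4 * Real.pi * t) ^ (-((n : ℝ) / 2)) * ∫ y, h y := by
  rw [gaussConv, ← integral_const_mul]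
  refine integral_mono (integrable_gaussKernel_mul ht hh x) (hh.const_mul _) fun y => ?_
  exact mul_le_mul_of_nonneg_right (gaussKernel_le ht _) (h0 y)

theorem gaussConv_nonneg {t : ℝ} (ht : 0 < t) {h : Rn n → ℝ} (h0 : ∀ x, 0 ≤ h x) (x : Rn n) :
    0 ≤ gaussConv t h x :=
  integral_nonneg fun y => mul_nonneg (gaussKernel_nonneg ht _) (h0 y)

theorem abs_gaussConv_le {t : ℝ} (ht : 0 < t) (h : Rn n → ℝ) (x : Rn n) :
    |gaussConv t h x| ≤ gaussConv t (fun y => |h y|) x := by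
  refine (abs_integral_le_integral_abs).trans_eq ?_
  refine integral_congr_ae (ae_of_all _ fun y => ?_)
  simp only [abs_mul, abs_of_nonneg (gaussKernel_nonneg ht _)]

theorem integrable_gaussKernel_sub {t : ℝ} (ht : 0 < t) (x : Rn n) :
    Integrable fun y => gaussKernel n t (x - y) :=
  (integrable_gaussKernel n ht).comp_sub_left x

theorem integral_gaussKernel_sub {t : ℝ} (ht : 0 < t) (x : Rn n) :
    ∫ y, gaussKernel n t (x - y) = 1 :=
  (integral_sub_left_eq_self (gaussKernel n t) volume x).trans (integral_gaussKernel ht)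

theorem abs_gaussConv_le_of_bdd {t : ℝ} (ht : 0 < t) {h : Rn n → ℝ} {c : ℝ}
    (hc : ∀ᵐ x, |h x| ≤ c) (x : Rn n) : |gaussConv t h x| ≤ c := by
  have : c = ∫ y, gaussKernel n t (x - y) * c := by
    rw [integral_mul_const, integral_gaussKernel_sub ht, one_mul]
  rw [this, ← Real.norm_eq_abs]
  refine norm_integral_le_of_norm_le ((integrable_gaussKernel_sub ht x).mul_const c) ?_
  filter_upwards [hc] with y hy
  rw [norm_mul, Real.norm_of_nonneg (gaussKernel_nonneg ht _)]
  exact mul_le_mul_of_nonneg_left hy (gaussKernel_nonneg ht _)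

theorem heat_of_nonpos {t : ℝ} (ht : t ≤ 0) (w : L1 n) : heat t w = w := dif_neg ht.not_gt

theorem coeFn_heat {t : ℝ} (ht : 0 < t) (w : L1 n) : heat t w =ᵐ[volume] gaussConv t w := by
  rw [heat, dif_pos ht, ← convolution_gaussKernel_eq]
  exact MemLp.coeFn_toLp _

theorem norm_heat_le (t : ℝ) (w : L1 n) : ‖heat t w‖ ≤ ‖w‖ := by
  rcases le_or_gt t 0 with ht | ht
  · rw [heat_of_nonpos ht]
  · have hw := (L1.integrable_coeFn w).abs
    rw [L1.norm_eq_integral_norm, L1.norm_eq_integral_norm]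
    calc ∫ x, ‖heat t w x‖ ≤ ∫ x, gaussConv t (fun y => |w y|) x := by
          refine integral_mono_ae (L1.integrable_coeFn _).norm (integrable_gaussConv ht hw) ?_
          filter_upwards [coeFn_heat ht w] with x hx
          rw [hx]; exact abs_gaussConv_le ht _ x
      _ = _ := integral_gaussConv ht hw

theorem heat_add_map (t : ℝ) (w v : L1 n) : heat t (w + v) = heat t w + heat t v := by
  rcases le_or_gt t 0 with ht | ht
  · simp only [heat_of_nonpos ht]
  · refine Lp.ext ?_
    filter_upwards [coeFn_heat ht (w + v), coeFn_heat ht w, coeFn_heat ht v,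
      Lp.coeFn_add (heat t w) (heat t v)] with x h1 h2 h3 h4
    rw [h1, h4, Pi.add_apply, h2, h3, gaussConv_congr (Lp.coeFn_add w v)]
    simp only [gaussConv, Pi.add_apply, mul_add]
    exact integral_add (integrable_gaussKernel_mul ht (L1.integrable_coeFn w) x)
      (integrable_gaussKernel_mul ht (L1.integrable_coeFn v) x)

theorem heat_smul (t r : ℝ) (w : L1 n) : heat t (r • w) = r • heat t w := by
  rcases le_or_gt t 0 with ht | ht
  · simp only [heat_of_nonpos ht]
  · refine Lp.ext ?_
    filter_upwards [coeFn_heat ht (r • w), coeFn_heat ht w,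
      Lp.coeFn_smul r (heat t w)] with x h1 h2 h4
    rw [h1, h4, Pi.smul_apply, h2, gaussConv_congr (Lp.coeFn_smul r w)]
    simp only [gaussConv, Pi.smul_apply, smul_eq_mul]
    rw [← integral_const_mul]
    congr 1; funext y; ring

/-- The heat semigroup as a family of bounded operators on `L¹`. -/
noncomputable def heatCLM (n : ℕ) (t : ℝ) : L1 n →L[ℝ] L1 n :=
  LinearMap.mkContinuous
    { toFun := heat t
      map_add' := heat_add_map t
      map_smul' := heat_smul t } 1 fun w => by rw [one_mul]; exact norm_heat_le t w

@[simp] theorem heatCLM_apply (t : ℝ) (w : L1 n) : heatCLM n t w = heat t w := rfl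

theorem heat_sub (t : ℝ) (w v : L1 n) : heat t (w - v) = heat t w - heat t v :=
  (heatCLM n t).map_sub w v

theorem BddAE.heat {c : ℝ} {w : L1 n} (hw : BddAE c w) (t : ℝ) : BddAE c (heat t w) := by
  rcases le_or_gt t 0 with ht | ht
  · rwa [heat_of_nonpos ht]
  · filter_upwards [coeFn_heat ht w] with x hx
    rw [hx]; exact abs_gaussConv_le_of_bdd ht hw x

theorem bddAE_heat {t : ℝ} (ht : 0 < t) (w : L1 n) :
    BddAE ((4 * Real.pi * t) ^ (-((n : ℝ) / 2)) * ‖w‖) (heat t w) := by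
  filter_upwards [coeFn_heat ht w] with x hx
  rw [hx, L1.norm_eq_integral_norm]
  exact (abs_gaussConv_le ht _ x).trans
    (gaussConv_le ht (L1.integrable_coeFn w).abs (fun _ => abs_nonneg _) x)

theorem gaussConv_gaussConv {a b : ℝ} (ha : 0 < a) (hb : 0 < b) {h : Rn n → ℝ}
    (hh : Integrable h) : gaussConv a (gaussConv b h) = gaussConv (a + b) h := by
  have hc : ∀ (c : ℝ), 0 < c → ∀ g : Rn n → ℝ, Integrable g →
      ConvolutionExists (gaussKernel n c) g (ContinuousLinearMap.mul ℝ ℝ) volume := by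
    intro c hc g hg x
    rw [convolutionExistsAt_iff_integrable_swap]
    exact integrable_gaussKernel_mul hc hg x
  have hn : ∀ c : ℝ, 0 < c → (fun x : Rn n => ‖gaussKernel n c x‖) = gaussKernel n c := by
    intro c hc; funext x; exact Real.norm_of_nonneg (gaussKernel_nonneg hc x)
  simp only [← convolution_gaussKernel_eq, ← gaussKernel_convolution_gaussKernel ha hb]
  funext x
  symm
  refine convolution_assoc _ _ _ _ (fun x y z => by simp [mul_assoc])
    (continuous_gaussKernel a).aestronglyMeasurable (continuous_gaussKernel b).aestronglyMeasurable
    hh.1 (ae_of_all _ (hc a ha _ (integrable_gaussKernel n hb))) ?_ ?_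
  · rw [hn b hb]; exact ae_of_all _ (hc b hb _ hh.norm)
  · rw [hn a ha, hn b hb, convolution_gaussKernel_eq]
    exact hc a ha _ (integrable_gaussConv hb hh.norm) x

theorem heat_heat {a b : ℝ} (ha : 0 ≤ a) (hb : 0 ≤ b) (w : L1 n) :
    heat a (heat b w) = heat (a + b) w := by
  rcases ha.eq_or_lt with rfl | ha
  · rw [heat_of_nonpos le_rfl, zero_add]
  rcases hb.eq_or_lt with rfl | hb
  · rw [heat_of_nonpos le_rfl, add_zero]
  refine Lp.ext ?_
  filter_upwards [coeFn_heat ha (heat b w), coeFn_heat (add_pos ha hb) w] with x h1 h2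
  rw [h1, h2, gaussConv_congr (coeFn_heat hb w),
    gaussConv_gaussConv ha hb (L1.integrable_coeFn w)]

theorem integrable_sq_norm_mul_gaussKernel {t : ℝ} (ht : 0 < t) :
    Integrable fun x : Rn n => (1 + ‖x‖ ^ 2 / t) * gaussKernel n t x := by
  refine ((integrable_gaussKernel n (t := 2 * t) (by positivity)).const_mul (domConst n)).mono'
    ?_ (ae_of_all _ fun x => ?_)
  · exact ((by fun_prop : Continuous fun x : Rn n => 1 + ‖x‖ ^ 2 / t).mul
      (continuous_gaussKernel t)).aestronglyMeasurable
  · rw [Real.norm_of_nonneg (mul_nonneg (by positivity) (gaussKernel_nonneg ht x))]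
    exact quadratic_mul_gaussKernel_le ht x

theorem integral_sq_norm_mul_gaussKernel_le {t : ℝ} (ht : 0 < t) :
    ∫ x : Rn n, (1 + ‖x‖ ^ 2 / t) * gaussKernel n t x ≤ domConst n := by
  have h2 : 0 < 2 * t := by positivity
  calc _ ≤ ∫ x : Rn n, domConst n * gaussKernel n (2 * t) x :=
        integral_mono (integrable_sq_norm_mul_gaussKernel ht)
          ((integrable_gaussKernel n h2).const_mul _) fun x => quadratic_mul_gaussKernel_le ht x
    _ = _ := by rw [integral_const_mul, integral_gaussKernel h2, mul_one]

/-- The `L¹` modulus of continuity of `w` under translations. -/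
noncomputable def translationModulus (w : L1 n) (z : Rn n) : ℝ := ∫ x, |w (x - z) - w x|

theorem continuous_translationModulus (w : L1 n) : Continuous (translationModulus w) := by
  have : Fact ((1 : ℝ≥0∞) ≠ ∞) := ⟨ENNReal.one_ne_top⟩
  have h : translationModulus w = fun z : Rn n => ‖(DomAddAct.mk (-z) +ᵥ w) - w‖ := by
    funext z
    rw [L1.norm_eq_integral_norm]
    refine integral_congr_ae ?_
    filter_upwards [Lp.coeFn_sub (DomAddAct.mk (-z) +ᵥ w) w,
      DomAddAct.vadd_Lp_ae_eq (DomAddAct.mk (-z)) w] with x h1 h2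
    rw [h1, Pi.sub_apply, h2, Equiv.symm_apply_apply, Real.norm_eq_abs, vadd_eq_add, neg_add_eq_sub]
  rw [h]
  have hc : Continuous fun z : Rn n => DomAddAct.mk (-z) :=
    DomAddAct.continuous_mk.comp continuous_neg
  exact ((hc.vadd continuous_const).sub continuous_const).norm

theorem translationModulus_zero (w : L1 n) : translationModulus w 0 = 0 := by
  simp [translationModulus]

theorem translationModulus_le (w : L1 n) (z : Rn n) : translationModulus w z ≤ 2 * ‖w‖ := by
  have hw := L1.integrable_coeFn w
  calc translationModulus w z ≤ ∫ x, (|w (x - z)| + |w x|) :=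
        integral_mono ((hw.comp_sub_right z).sub hw).abs ((hw.comp_sub_right z).abs.add hw.abs)
          fun x => abs_sub _ _
    _ = 2 * ‖w‖ := by
        rw [integral_add (hw.comp_sub_right z).abs hw.abs,
          integral_sub_right_eq_self (fun x => |w x|), L1.norm_eq_integral_norm]
        simp only [Real.norm_eq_abs]; ring

theorem norm_heat_sub_self_le {t : ℝ} (ht : 0 < t) (w : L1 n) :
    ‖heat t w - w‖ ≤ ∫ z, gaussKernel n t z * translationModulus w z := by
  have hw := L1.integrable_coeFn w
  have hG := integrable_gaussKernel n ht
  have i1 : Integrable (fun p : Rn n × Rn n => gaussKernel n t p.2 * w (p.1 - p.2)) :=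
    hG.convolution_integrand (ContinuousLinearMap.mul ℝ ℝ) hw
  have i2 : Integrable (fun p : Rn n × Rn n => w p.1 * gaussKernel n t p.2) := hw.mul_prod hG
  have i3 : Integrable
      (fun p : Rn n × Rn n => gaussKernel n t p.2 * |w (p.1 - p.2) - w p.1|) := by
    refine (i1.sub i2).abs.congr (ae_of_all _ fun p => ?_)
    simp only [Pi.sub_apply]
    rw [mul_comm (w p.1), ← mul_sub, abs_mul, abs_of_nonneg (gaussKernel_nonneg ht _)]
  have hx : ∀ᵐ x, ‖(heat t w - w : L1 n) x‖ ≤ ∫ z, gaussKernel n t z * |w (x - z) - w x| := by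
    filter_upwards [Lp.coeFn_sub (heat t w) w, coeFn_heat ht w] with x h1 h2
    have j1 : Integrable fun z => gaussKernel n t z * w (x - z) := by
      refine ((integrable_gaussKernel_mul ht hw x).comp_sub_left x).congr (ae_of_all _ fun z => ?_)
      simp
    have e1 : gaussConv t w x = ∫ z, gaussKernel n t z * w (x - z) := by
      rw [← convolution_gaussKernel_eq, convolution_mul]
    have e2 : gaussConv t w x - w x =
        ∫ z, (gaussKernel n t z * w (x - z) - gaussKernel n t z * w x) := by
      rw [integral_sub j1 (hG.mul_const _), e1, integral_mul_const, integral_gaussKernel ht,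
        one_mul]
    rw [h1, Pi.sub_apply, h2, e2]
    refine (norm_integral_le_integral_norm _).trans_eq (integral_congr_ae (ae_of_all _ fun z => ?_))
    simp only
    rw [← mul_sub, norm_mul, Real.norm_of_nonneg (gaussKernel_nonneg ht _), Real.norm_eq_abs]
  rw [L1.norm_eq_integral_norm]
  calc _ ≤ ∫ x, ∫ z, gaussKernel n t z * |w (x - z) - w x| :=
        integral_mono_ae (L1.integrable_coeFn _).norm i3.integral_prod_left hx
    _ = ∫ z, ∫ x, gaussKernel n t z * |w (x - z) - w x| := integral_integral_swap i3
    _ = _ := by simp only [integral_const_mul]; rfl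

theorem tendsto_heat_zero (w : L1 n) {ε : ℝ} (hε : 0 < ε) :
    ∃ δ > 0, ∀ t, 0 ≤ t → t < δ → ‖heat t w - w‖ ≤ ε := by
  have hc := (continuous_translationModulus w).continuousAt (x := 0)
  rw [Metric.continuousAt_iff] at hc
  obtain ⟨r, hr, hr'⟩ := hc (ε / 2) (by positivity)
  set C := 2 * ‖w‖ / r ^ 2 with hC
  have hC0 : 0 ≤ C := by positivity
  have hD := one_le_domConst n
  have hm : ∀ z : Rn n, translationModulus w z ≤ ε / 2 + C * ‖z‖ ^ 2 := by
    intro z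
    by_cases hz : ‖z‖ < r
    · have h1 := hr' (x := z) (by simpa using hz)
      rw [translationModulus_zero, Real.dist_eq, sub_zero] at h1
      have h2 : 0 ≤ C * ‖z‖ ^ 2 := by positivity
      linarith [le_abs_self (translationModulus w z)]
    · have h1 := translationModulus_le w z
      have h2 : 2 * ‖w‖ ≤ C * ‖z‖ ^ 2 := by
        rw [hC, div_mul_eq_mul_div, le_div_iff₀ (by positivity)]
        have : r ^ 2 ≤ ‖z‖ ^ 2 := by gcongr; exact not_lt.1 hz
        gcongr
      linarith
  refine ⟨ε / (2 * (C * domConst n + 1)), by positivity, fun t ht0 ht1 => ?_⟩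
  rcases ht0.eq_or_lt with rfl | ht
  · rw [heat_of_nonpos le_rfl, sub_self, norm_zero]; exact hε.le
  refine (norm_heat_sub_self_le ht w).trans ?_
  have hG := integrable_gaussKernel n ht
  have hQ := integrable_sq_norm_mul_gaussKernel (n := n) ht
  have bound : ∀ z : Rn n, gaussKernel n t z * translationModulus w z ≤
      ε / 2 * gaussKernel n t z + C * t * ((1 + ‖z‖ ^ 2 / t) * gaussKernel n t z) := by
    intro z
    have hg := gaussKernel_nonneg ht z
    calc _ ≤ gaussKernel n t z * (ε / 2 + C * ‖z‖ ^ 2) := by gcongr; exact hm z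
      _ = ε / 2 * gaussKernel n t z + C * t * ((‖z‖ ^ 2 / t) * gaussKernel n t z) := by
        field_simp
      _ ≤ _ := by gcongr; linarith
  calc _ ≤ ∫ z, (ε / 2 * gaussKernel n t z + C * t * ((1 + ‖z‖ ^ 2 / t) * gaussKernel n t z)) := by
        refine integral_mono_of_nonneg (ae_of_all _ fun z => ?_)
          ((hG.const_mul _).add (hQ.const_mul _)) (ae_of_all _ bound)
        exact mul_nonneg (gaussKernel_nonneg ht z) (integral_nonneg fun _ => abs_nonneg _)
    _ = ε / 2 + C * t * ∫ z, (1 + ‖z‖ ^ 2 / t) * gaussKernel n t z := by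
        rw [integral_add (hG.const_mul _) (hQ.const_mul _), integral_const_mul, integral_const_mul,
          integral_gaussKernel ht, mul_one]
    _ ≤ ε / 2 + C * t * domConst n := by
        gcongr; exact integral_sq_norm_mul_gaussKernel_le ht
    _ ≤ ε := by
        rw [lt_div_iff₀ (by positivity)] at ht1
        nlinarith

theorem norm_heat_sub_heat_le {a b : ℝ} (ha : 0 ≤ a) (hab : a ≤ b) (w : L1 n) :
    ‖heat b w - heat a w‖ ≤ ‖heat (b - a) w - w‖ := by
  have : heat b w = heat a (heat (b - a) w) := by
    rw [heat_heat ha (by linarith)]; congr 1; ring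
  rw [this, ← heat_sub]
  exact norm_heat_le _ _

theorem continuous_heat_time (w : L1 n) : Continuous fun t : ℝ => heat t w := by
  have e : (fun t : ℝ => heat t w) = fun t => heat (max t 0) w := by
    funext t
    rcases le_total t 0 with h | h
    · rw [max_eq_right h, heat_of_nonpos h, heat_of_nonpos le_rfl]
    · rw [max_eq_left h]
  rw [e, Metric.continuous_iff]
  intro t ε hε
  obtain ⟨δ, hδ, h⟩ := tendsto_heat_zero w (half_pos hε)
  refine ⟨δ, hδ, fun s hs => ?_⟩
  have hd : |max s 0 - max t 0| < δ := lt_of_le_of_lt (abs_max_sub_max_le_abs s t 0) hs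
  rw [dist_eq_norm]
  rcases le_total (max t 0) (max s 0) with h1 | h1
  · refine lt_of_le_of_lt ((norm_heat_sub_heat_le (le_max_right _ _) h1 w).trans
      (h _ (by linarith) ?_)) (by linarith)
    rwa [abs_of_nonneg (by linarith)] at hd
  · rw [norm_sub_rev]
    refine lt_of_le_of_lt ((norm_heat_sub_heat_le (le_max_right _ _) h1 w).trans
      (h _ (by linarith) ?_)) (by linarith)
    rwa [abs_sub_comm, abs_of_nonneg (by linarith)] at hd

theorem continuous_heat : Continuous fun q : ℝ × L1 n => heat q.1 q.2 := by
  rw [continuous_iff_continuousAt]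
  rintro ⟨t, w⟩
  rw [Metric.continuousAt_iff]
  intro ε hε
  obtain ⟨δ, hδ, h⟩ := Metric.continuous_iff.1 (continuous_heat_time w) t (ε / 2) (half_pos hε)
  refine ⟨min δ (ε / 2), by positivity, fun {q} hq => ?_⟩
  rw [Prod.dist_eq, max_lt_iff] at hq
  have h1 := h q.1 (hq.1.trans_le (min_le_left _ _))
  have h2 : dist (heat q.1 q.2) (heat q.1 w) ≤ dist q.2 w := by
    rw [dist_eq_norm, dist_eq_norm, ← heat_sub]; exact norm_heat_le _ _
  have h3 := hq.2.trans_le (min_le_right _ _)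
  calc _ ≤ dist (heat q.1 q.2) (heat q.1 w) + dist (heat q.1 w) (heat t w) := dist_triangle _ _ _
    _ < _ := by simp only at h3; linarith

variable {f : ℝ → ℝ} {K p : ℝ}

/-- The growth condition `|f(ξ) - f(η)| ≤ K (|ξ|^{p-1} + |η|^{p-1}) |ξ - η|` with `f(0) = 0`. -/
structure PowerGrowth (f : ℝ → ℝ) (K p : ℝ) : Prop where
  one_lt : 1 < p
  pos : 0 < K
  lip : ∀ ξ η : ℝ, |f ξ - f η| ≤ K * (|ξ| ^ (p - 1) + |η| ^ (p - 1)) * |ξ - η|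
  zero : f 0 = 0

namespace PowerGrowth

theorem abs_le (h : PowerGrowth f K p) {ξ c : ℝ} (hξ : |ξ| ≤ c) : |f ξ| ≤ K * c ^ (p - 1) * |ξ| := by
  have h1 := h.lip ξ 0
  have h2 := h.one_lt
  have h3 := h.pos
  rw [h.zero, sub_zero, sub_zero, abs_zero, Real.zero_rpow (by linarith), add_zero] at h1
  refine h1.trans ?_
  gcongr

theorem abs_sub_le (h : PowerGrowth f K p) {ξ η c : ℝ} (hξ : |ξ| ≤ c) (hη : |η| ≤ c) :
    |f ξ - f η| ≤ 2 * K * c ^ (p - 1) * |ξ - η| := by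
  have h2 := h.one_lt
  have h3 := h.pos
  have h4 : |ξ| ^ (p - 1) ≤ c ^ (p - 1) := by gcongr
  have h5 : |η| ^ (p - 1) ≤ c ^ (p - 1) := by gcongr
  calc _ ≤ K * (|ξ| ^ (p - 1) + |η| ^ (p - 1)) * |ξ - η| := h.lip ξ η
    _ ≤ K * (c ^ (p - 1) + c ^ (p - 1)) * |ξ - η| := by gcongr
    _ = _ := by ring

theorem continuous (h : PowerGrowth f K p) : Continuous f := by
  rw [continuous_iff_continuousAt]
  intro η
  have h0 : 0 < p - 1 := by linarith [h.one_lt]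
  rw [ContinuousAt, tendsto_iff_dist_tendsto_zero]
  have hlim : Filter.Tendsto
      (fun ξ : ℝ => K * (|ξ| ^ (p - 1) + |η| ^ (p - 1)) * |ξ - η|) (nhds η) (nhds 0) := by
    have hc : Continuous fun ξ : ℝ => K * (|ξ| ^ (p - 1) + |η| ^ (p - 1)) * |ξ - η| := by
      have : Continuous fun ξ : ℝ => |ξ| ^ (p - 1) :=
        continuous_abs.rpow_const fun _ => Or.inr h0.le
      fun_prop
    simpa using hc.tendsto η
  exact squeeze_zero (fun _ => dist_nonneg) (fun ξ => h.lip ξ η) hlim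

theorem memLp (h : PowerGrowth f K p) {c : ℝ} {w : L1 n} (hw : BddAE c w) :
    MemLp (fun x => f (w x)) 1 volume := by
  rw [memLp_one_iff_integrable]
  refine ((L1.integrable_coeFn w).abs.const_mul (K * c ^ (p - 1))).mono'
    (h.continuous.comp_aestronglyMeasurable (Lp.aestronglyMeasurable w)) ?_
  filter_upwards [hw] with x hx
  exact h.abs_le hx

theorem coeFn_nonlin (h : PowerGrowth f K p) {c : ℝ} {w : L1 n} (hw : BddAE c w) :
    nonlin f w =ᵐ[volume] fun x => f (w x) := by
  rw [nonlin, dif_pos (h.memLp hw)]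
  exact MemLp.coeFn_toLp _

theorem norm_nonlin_le (h : PowerGrowth f K p) {c : ℝ} {w : L1 n} (hw : BddAE c w) :
    ‖nonlin f w‖ ≤ K * c ^ (p - 1) * ‖w‖ := by
  rw [L1.norm_eq_integral_norm, L1.norm_eq_integral_norm, ← integral_const_mul]
  refine integral_mono_ae (L1.integrable_coeFn _).norm
    ((L1.integrable_coeFn w).norm.const_mul _) ?_
  filter_upwards [hw, h.coeFn_nonlin hw] with x hx h1
  rw [h1]
  exact h.abs_le hx

theorem norm_nonlin_sub_le (h : PowerGrowth f K p) {c : ℝ} {w v : L1 n} (hw : BddAE c w)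
    (hv : BddAE c v) : ‖nonlin f w - nonlin f v‖ ≤ 2 * K * c ^ (p - 1) * ‖w - v‖ := by
  rw [L1.norm_eq_integral_norm, L1.norm_eq_integral_norm, ← integral_const_mul]
  refine integral_mono_ae (L1.integrable_coeFn _).norm
    ((L1.integrable_coeFn (w - v)).norm.const_mul _) ?_
  filter_upwards [hw, hv, h.coeFn_nonlin hw, h.coeFn_nonlin hv, Lp.coeFn_sub w v,
    Lp.coeFn_sub (nonlin f w) (nonlin f v)] with x hx hy h1 h2 h3 h4
  rw [h3, h4, Pi.sub_apply, Pi.sub_apply, h1, h2]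
  exact h.abs_sub_le hx hy

theorem bddAE_nonlin (h : PowerGrowth f K p) {c : ℝ} (hc : 0 ≤ c) {w : L1 n} (hw : BddAE c w) :
    BddAE (K * c ^ (p - 1) * c) (nonlin f w) := by
  have := h.pos
  filter_upwards [hw, h.coeFn_nonlin hw] with x hx h1
  rw [h1]
  exact (h.abs_le hx).trans (by gcongr)

theorem norm_weightMul_nonlin_le (h : PowerGrowth f K p) {c : ℝ} {w : L1 n} (hw : BddAE c w)
    {W : Rn n → ℝ} (hW : Continuous W) {R : ℝ} (hR : ∀ x, |W x| ≤ R) :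
    ‖weightMul hW hR (nonlin f w)‖ ≤ K * c ^ (p - 1) * ‖weightMul hW hR w‖ := by
  rw [norm_weightMul, norm_weightMul, ← integral_const_mul]
  have i : ∀ v : L1 n, Integrable fun x => |W x| * |v x| := fun v =>
    (memLp_one_iff_integrable.1 (memLp_weight_mul hW hR v)).abs.congr
      (ae_of_all _ fun x => abs_mul _ _)
  refine integral_mono_ae (i _) ((i w).const_mul _) ?_
  filter_upwards [hw, h.coeFn_nonlin hw] with x hx h1
  rw [h1]
  calc |W x| * |f (w x)| ≤ |W x| * (K * c ^ (p - 1) * |w x|) := by gcongr; exact h.abs_le hx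
    _ = _ := by ring

end PowerGrowth

/-- The decay rate `(1+t)^{-n/2}` of the `L^∞` norm. -/
noncomputable def rho (n : ℕ) (t : ℝ) : ℝ := (1 + t) ^ (-((n : ℝ) / 2))

theorem rho_pos {t : ℝ} (ht : 0 ≤ t) : 0 < rho n t := by unfold rho; positivity

theorem rho_le_one {t : ℝ} (ht : 0 ≤ t) : rho n t ≤ 1 :=
  Real.rpow_le_one_of_one_le_of_nonpos (by linarith)
    (by have : (0 : ℝ) ≤ n := by positivity
        linarith)

theorem rho_rpow {t : ℝ} (ht : 0 ≤ t) (p : ℝ) :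
    rho n t ^ (p - 1) = (t + 1) ^ (-((n : ℝ) / 2 * (p - 1))) := by
  rw [rho, ← Real.rpow_mul (by linarith), add_comm]; congr 1; ring

theorem integrableOn_rho_rpow {p : ℝ} (h : 1 < (n : ℝ) / 2 * (p - 1)) :
    IntegrableOn (fun s => rho n s ^ (p - 1)) (Ioi 0) :=
  (integrableOn_add_rpow_Ioi_of_lt (a := -((n : ℝ) / 2 * (p - 1))) (c := 0) (m := 1)
    (by linarith) (by norm_num)).congr_fun (fun s hs => (rho_rpow (le_of_lt hs) p).symm)
    measurableSet_Ioi

theorem rho_le_of_half_le {a b : ℝ} (hb : 0 ≤ b) (h : (1 + b) / 2 ≤ 1 + a) :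
    rho n a ≤ 2 ^ ((n : ℝ) / 2) * rho n b := by
  unfold rho
  calc (1 + a) ^ (-((n : ℝ) / 2)) ≤ ((1 + b) / 2) ^ (-((n : ℝ) / 2)) :=
        Real.rpow_le_rpow_of_nonpos (by positivity) h
          (by have : (0 : ℝ) ≤ n := by positivity
              linarith)
    _ = _ := by
        rw [div_eq_inv_mul, Real.mul_rpow (by positivity) (by positivity),
          Real.inv_rpow (by positivity), Real.rpow_neg (by positivity) (_ / _), inv_inv]

theorem bddAE_heat_rho {w : L1 n} {a c : ℝ} (ha : ‖w‖ ≤ a) (hc0 : 0 ≤ c) (hc : BddAE c w) {τ : ℝ}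
    (hτ : 0 ≤ τ) : BddAE (2 ^ ((n : ℝ) / 2) * rho n τ * (a + c)) (heat τ w) := by
  have ha0 : 0 ≤ a := (norm_nonneg _).trans ha
  have hρ := rho_pos (n := n) hτ
  have h2 : (1 : ℝ) ≤ 2 ^ ((n : ℝ) / 2) := Real.one_le_rpow (by norm_num) (by positivity)
  rcases le_total τ 1 with h | h
  · refine (hc.heat τ).mono ?_
    have h1 : rho n 0 ≤ 2 ^ ((n : ℝ) / 2) * rho n τ :=
      rho_le_of_half_le hτ (by linarith)
    have h0 : rho n 0 = 1 := by simp [rho]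
    rw [h0] at h1
    nlinarith
  · refine (bddAE_heat (by linarith) w).mono ?_
    have h1 : (4 * Real.pi * τ) ^ (-((n : ℝ) / 2)) ≤ rho n τ := by
      refine Real.rpow_le_rpow_of_nonpos (by positivity) ?_
        (by have : (0 : ℝ) ≤ n := by positivity
            linarith)
      have := Real.pi_gt_three
      nlinarith
    calc _ ≤ rho n τ * a := by gcongr
      _ ≤ rho n τ * (a + c) := by gcongr; linarith
      _ ≤ 2 ^ ((n : ℝ) / 2) * (rho n τ * (a + c)) := le_mul_of_one_le_left (by positivity) h2
      _ = _ := by ring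

theorem bddAE_heat_sub_time {w : L1 n} {b s t : ℝ} (hb : ‖w‖ ≤ b) (hs : 0 ≤ s) (hst : s ≤ t)
    (hw : BddAE (b * rho n s) w) : BddAE (2 ^ (n + 1) * b * rho n t) (heat (t - s) w) := by
  have hb0 : 0 ≤ b := (norm_nonneg _).trans hb
  have ht : 0 ≤ t := hs.trans hst
  have hρs := rho_pos (n := n) hs
  have hρt := rho_pos (n := n) ht
  have h2 : (1 : ℝ) ≤ 2 ^ ((n : ℝ) / 2) := Real.one_le_rpow (by norm_num) (by positivity)
  have h22 : (2 : ℝ) ^ ((n : ℝ) / 2) * 2 ^ ((n : ℝ) / 2) = 2 ^ n := by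
    rw [← Real.rpow_add (by norm_num), ← Real.rpow_natCast]; congr 1; ring
  rcases le_total s (t / 2) with h | h
  · have h1 : rho n (t - s) ≤ 2 ^ ((n : ℝ) / 2) * rho n t :=
      rho_le_of_half_le ht (by linarith)
    have h3 : b * rho n s ≤ b := mul_le_of_le_one_right hb0 (rho_le_one hs)
    refine (bddAE_heat_rho hb (by positivity) hw (sub_nonneg.2 hst)).mono ?_
    calc _ ≤ 2 ^ ((n : ℝ) / 2) * (2 ^ ((n : ℝ) / 2) * rho n t) * (b + b) := by gcongr
      _ = (2 ^ ((n : ℝ) / 2) * 2 ^ ((n : ℝ) / 2)) * 2 * b * rho n t := by ring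
      _ = _ := by rw [h22]; ring
  · refine (hw.heat _).mono ?_
    have h1 : rho n s ≤ 2 ^ ((n : ℝ) / 2) * rho n t :=
      rho_le_of_half_le ht (by linarith)
    have h3 : (2 : ℝ) ^ ((n : ℝ) / 2) ≤ 2 ^ (n + 1) := by
      have := one_le_pow₀ (n := n) (by norm_num : (1 : ℝ) ≤ 2)
      rw [pow_succ]; nlinarith
    calc _ ≤ b * (2 ^ ((n : ℝ) / 2) * rho n t) := by gcongr
      _ ≤ b * (2 ^ (n + 1) * rho n t) := by gcongr
      _ = _ := by ring

theorem PowerGrowth.continuousOn_nonlin (h : PowerGrowth f K p) {c : ℝ} (hc : 0 ≤ c) :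
    ContinuousOn (nonlin f) {w : L1 n | BddAE c w} := by
  have hK := h.pos
  refine LipschitzOnWith.continuousOn (K := (2 * K * c ^ (p - 1)).toNNReal) ?_
  refine LipschitzOnWith.of_dist_le_mul fun w hw v hv => ?_
  rw [Real.coe_toNNReal _ (by positivity), dist_eq_norm, dist_eq_norm]
  exact h.norm_nonlin_sub_le hw hv

theorem continuousOn_heat_comp {F : ℝ → L1 n} {S : Set ℝ} (hF : ContinuousOn F S) (t : ℝ) :
    ContinuousOn (fun s => heat (t - s) (F s)) S :=
  continuous_heat.comp_continuousOn
    ((continuousOn_const.sub continuousOn_id).prodMk hF)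

theorem intervalIntegrable_of_continuousOn {E : Type*} [NormedAddCommGroup E] {F : ℝ → E}
    (hF : ContinuousOn F (Ici 0)) {a b : ℝ} (ha : 0 ≤ a) (hb : 0 ≤ b) :
    IntervalIntegrable F volume a b :=
  (hF.mono fun _ hx => (le_min ha hb).trans hx.1).intervalIntegrable

/-- Uniform bounds `‖u(t)‖₁ ≤ M`, `‖u(t)‖_∞ ≤ M (1+t)^{-n/2}` for `t ≥ 0`. -/
structure DecayBound (M : ℝ) (u : ℝ → L1 n) : Prop where
  nonneg : 0 ≤ M
  continuousOn : ContinuousOn u (Ici 0)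
  norm_le : ∀ t, 0 ≤ t → ‖u t‖ ≤ M
  bdd : ∀ t, 0 ≤ t → BddAE (M * rho n t) (u t)

namespace DecayBound

variable {M : ℝ} {u v : ℝ → L1 n}

theorem bdd_const (hu : DecayBound M u) {t : ℝ} (ht : 0 ≤ t) : BddAE M (u t) :=
  (hu.bdd t ht).mono (mul_le_of_le_one_right hu.nonneg (rho_le_one ht))

theorem rpow_eq (hu : DecayBound M u) {s : ℝ} (hs : 0 ≤ s) :
    (M * rho n s) ^ (p - 1) = M ^ (p - 1) * rho n s ^ (p - 1) :=
  Real.mul_rpow hu.nonneg (rho_pos hs).le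

theorem norm_nonlin_le (hu : DecayBound M u) (h : PowerGrowth f K p) {s : ℝ} (hs : 0 ≤ s) :
    ‖nonlin f (u s)‖ ≤ K * M ^ (p - 1) * M * rho n s ^ (p - 1) := by
  have hK := h.pos
  have hM := hu.nonneg
  have hρ := rho_pos (n := n) hs
  refine (h.norm_nonlin_le (hu.bdd s hs)).trans ?_
  rw [hu.rpow_eq hs]
  calc _ ≤ K * (M ^ (p - 1) * rho n s ^ (p - 1)) * M := by gcongr; exact hu.norm_le s hs
    _ = _ := by ring

theorem norm_nonlin_sub_le (hu : DecayBound M u) (hv : DecayBound M v) (h : PowerGrowth f K p)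
    {s : ℝ} (hs : 0 ≤ s) : ‖nonlin f (u s) - nonlin f (v s)‖ ≤
      2 * K * M ^ (p - 1) * rho n s ^ (p - 1) * ‖u s - v s‖ := by
  have := h.norm_nonlin_sub_le (hu.bdd s hs) (hv.bdd s hs)
  rwa [hu.rpow_eq hs, ← mul_assoc] at this

theorem bddAE_nonlin (hu : DecayBound M u) (h : PowerGrowth f K p) {s : ℝ} (hs : 0 ≤ s) :
    BddAE (K * M ^ (p - 1) * M * rho n s ^ (p - 1) * rho n s) (nonlin f (u s)) := by
  have hρ := rho_pos (n := n) hs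
  refine (h.bddAE_nonlin (mul_nonneg hu.nonneg hρ.le) (hu.bdd s hs)).mono (le_of_eq ?_)
  rw [hu.rpow_eq hs]; ring

theorem norm_weightMul_nonlin_le (hu : DecayBound M u) (h : PowerGrowth f K p) {s : ℝ} (hs : 0 ≤ s)
    {W : Rn n → ℝ} (hW : Continuous W) {R : ℝ} (hR : ∀ x, |W x| ≤ R) :
    ‖weightMul hW hR (nonlin f (u s))‖ ≤
      K * M ^ (p - 1) * rho n s ^ (p - 1) * ‖weightMul hW hR (u s)‖ := by
  have := h.norm_weightMul_nonlin_le (hu.bdd s hs) hW hR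
  rwa [hu.rpow_eq hs, ← mul_assoc] at this

theorem continuousOn_nonlin (hu : DecayBound M u) (h : PowerGrowth f K p) :
    ContinuousOn (fun s => nonlin f (u s)) (Ici 0) :=
  (h.continuousOn_nonlin hu.nonneg).comp hu.continuousOn fun _ ht => hu.bdd_const ht

theorem intervalIntegrable (hu : DecayBound M u) (h : PowerGrowth f K p) (r : ℝ) {a b : ℝ}
    (ha : 0 ≤ a) (hb : 0 ≤ b) :
    IntervalIntegrable (fun s => heat (r - s) (nonlin f (u s))) volume a b :=
  intervalIntegrable_of_continuousOn (continuousOn_heat_comp (hu.continuousOn_nonlin h) r) ha hb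

theorem bddAE_heat_nonlin (hu : DecayBound M u) (h : PowerGrowth f K p) {s t : ℝ} (hs : 0 ≤ s)
    (hst : s ≤ t) : BddAE (2 ^ (n + 1) * (K * M ^ (p - 1) * M) * rho n t * rho n s ^ (p - 1))
      (heat (t - s) (nonlin f (u s))) :=
  (bddAE_heat_sub_time (hu.norm_nonlin_le h hs) hs hst (hu.bddAE_nonlin h hs)).mono
    (le_of_eq (by ring))

end DecayBound

/-- The total mass `∫₀^∞ (1+s)^{-(n/2)(p-1)} ds`. -/
noncomputable def rhoMass (n : ℕ) (p : ℝ) : ℝ := ∫ s in Ioi (0 : ℝ), rho n s ^ (p - 1)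

theorem rhoMass_nonneg (n : ℕ) (p : ℝ) : 0 ≤ rhoMass n p :=
  setIntegral_nonneg measurableSet_Ioi fun s hs => by
    have := rho_pos (n := n) (le_of_lt hs); positivity

theorem setIntegral_rho_le {p : ℝ} (hσ : 1 < (n : ℝ) / 2 * (p - 1)) (t : ℝ) :
    ∫ s in Ioc 0 t, rho n s ^ (p - 1) ≤ rhoMass n p := by
  refine setIntegral_mono_set (integrableOn_rho_rpow hσ) ?_ (Ioc_subset_Ioi_self).eventuallyLE
  refine (ae_restrict_mem measurableSet_Ioi).mono fun s hs => ?_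
  have := rho_pos (n := n) (le_of_lt hs)
  simp only [Pi.zero_apply]; positivity

theorem norm_intervalIntegral_rho_le (hσ : 1 < (n : ℝ) / 2 * (p - 1)) {E : Type*}
    [NormedAddCommGroup E] [NormedSpace ℝ E] {F : ℝ → E} {C t : ℝ} (hC : 0 ≤ C) (ht : 0 ≤ t)
    (h : ∀ s, 0 < s → s ≤ t → ‖F s‖ ≤ C * rho n s ^ (p - 1)) :
    ‖∫ s in (0 : ℝ)..t, F s‖ ≤ C * rhoMass n p := by
  rw [intervalIntegral.integral_of_le ht]
  have hi : IntegrableOn (fun s => C * rho n s ^ (p - 1)) (Ioc 0 t) :=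
    ((integrableOn_rho_rpow hσ).mono_set Ioc_subset_Ioi_self).const_mul C
  refine (norm_integral_le_of_norm_le hi ?_).trans ?_
  · exact (ae_restrict_mem measurableSet_Ioc).mono fun s hs => h s hs.1 hs.2
  · rw [integral_const_mul]
    gcongr
    exact setIntegral_rho_le hσ t

theorem bddAE_intervalIntegral_rho (hσ : 1 < (n : ℝ) / 2 * (p - 1)) {F : ℝ → L1 n} {C t : ℝ}
    (hC : 0 ≤ C) (ht : 0 ≤ t) (hF : IntervalIntegrable F volume 0 t)
    (h : ∀ s, 0 < s → s ≤ t → BddAE (C * rho n s ^ (p - 1)) (F s)) :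
    BddAE (C * rhoMass n p) (∫ s in (0 : ℝ)..t, F s) := by
  rw [intervalIntegral.integral_of_le ht]
  have hi : IntegrableOn (fun s => C * rho n s ^ (p - 1)) (Ioc 0 t) :=
    ((integrableOn_rho_rpow hσ).mono_set Ioc_subset_Ioi_self).const_mul C
  refine (BddAE.integral ((intervalIntegrable_iff_integrableOn_Ioc_of_le ht).1 hF) hi ?_).mono ?_
  · exact (ae_restrict_mem measurableSet_Ioc).mono fun s hs => h s hs.1 hs.2
  · rw [integral_const_mul]
    gcongr
    exact setIntegral_rho_le hσ t

/-- The smallness condition on the size `M` of solutions. -/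
structure SmallRadius (n : ℕ) (K p M : ℝ) : Prop where
  pos : 0 < M
  le : 2 ^ (n + 1) * (K * M ^ (p - 1)) * rhoMass n p ≤ 1 / 4

theorem exists_smallRadius (n : ℕ) {K p : ℝ} (hK : 0 < K) (hp : 1 < p) :
    ∃ M, SmallRadius n K p M := by
  have hI := rhoMass_nonneg n p
  set D := 2 ^ (n + 1) * K * rhoMass n p + 1 with hD
  have hD0 : 0 < D := by positivity
  refine ⟨(1 / (4 * D)) ^ (1 / (p - 1)), by positivity, ?_⟩
  have hp' : p - 1 ≠ 0 := by linarith
  rw [← Real.rpow_mul (by positivity), one_div_mul_cancel hp', Real.rpow_one]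
  have : 2 ^ (n + 1) * (K * (1 / (4 * D))) * rhoMass n p = (D - 1) / (4 * D) := by
    rw [hD]; ring
  rw [this, div_le_div_iff₀ (by positivity) (by norm_num)]
  linarith

section FixedPoint

open BoundedContinuousFunction

variable (n) in
/-- The complete metric space in which the solution is found. -/
def SolutionSpace (M : ℝ) : Set (ℝ →ᵇ L1 n) :=
  {u | ∀ t, ‖u t‖ ≤ M ∧ BddAE (M * rho n (max t 0)) (u t)}

theorem isClosed_solutionSpace (M : ℝ) : IsClosed (SolutionSpace n M) := by
  have : SolutionSpace n M = ⋂ t : ℝ, {u : ℝ →ᵇ L1 n | ‖u t‖ ≤ M} ∩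
      (fun u : ℝ →ᵇ L1 n => u t) ⁻¹' {w | BddAE (M * rho n (max t 0)) w} := by
    ext u
    simp only [SolutionSpace, mem_ofPred_eq, mem_iInter, mem_inter_iff, mem_preimage]
  rw [this]
  refine isClosed_iInter fun t => IsClosed.inter ?_ ?_
  · exact isClosed_le (continuous_eval_const t).norm continuous_const
  · exact (isClosed_bddAE _).preimage (continuous_eval_const t)

theorem SolutionSpace.decayBound {M : ℝ} (hM : 0 ≤ M) {u : ℝ →ᵇ L1 n} (hu : u ∈ SolutionSpace n M) :
    DecayBound M u where
  nonneg := hM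
  continuousOn := u.continuous.continuousOn
  norm_le t _ := (hu t).1
  bdd t ht := by have := (hu t).2; rwa [max_eq_left ht] at this

/-- The right hand side of Duhamel's formula, frozen at the initial value for negative times. -/
noncomputable def duhamelMap (f : ℝ → ℝ) (φ : L1 n) (u : ℝ → L1 n) (t : ℝ) : L1 n :=
  heat t φ + ∫ s in (0 : ℝ)..(max t 0), heat (t - s) (nonlin f (u s))

theorem continuous_duhamelMap (h : PowerGrowth f K p) (φ : L1 n) {M : ℝ} (hM : 0 ≤ M)
    {u : ℝ →ᵇ L1 n} (hu : u ∈ SolutionSpace n M) : Continuous (duhamelMap f φ u) := by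
  refine (continuous_heat_time φ).add ?_
  have hN : Continuous fun s => nonlin f (u s) := by
    rw [← continuousOn_univ]
    refine (h.continuousOn_nonlin hM).comp u.continuous.continuousOn fun t _ => ?_
    exact (hu t).2.mono (mul_le_of_le_one_right hM (rho_le_one (le_max_right _ _)))
  refine intervalIntegral.continuous_parametric_intervalIntegral_of_continuous
    (f := fun t s => heat (t - s) (nonlin f (u s))) ?_ (continuous_id.max continuous_const)
  exact continuous_heat.comp ((continuous_fst.sub continuous_snd).prodMk (hN.comp continuous_snd))

theorem duhamelMap_of_nonpos {φ : L1 n} {u : ℝ → L1 n} {t : ℝ} (ht : t ≤ 0) :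
    duhamelMap f φ u t = duhamelMap f φ u 0 := by
  rw [duhamelMap, duhamelMap, max_eq_right ht, max_eq_right le_rfl,
    intervalIntegral.integral_same, intervalIntegral.integral_same, heat_of_nonpos ht,
    heat_of_nonpos le_rfl]

theorem duhamelMap_mem (h : PowerGrowth f K p) (hσ : 1 < (n : ℝ) / 2 * (p - 1)) {M : ℝ}
    (hM : SmallRadius n K p M) {φ : L1 n} (hφ1 : ‖φ‖ ≤ M / 2 ^ (n + 2))
    (hφ2 : BddAE (M / 2 ^ (n + 2)) φ) {u : ℝ → L1 n} (hu : DecayBound M u) (t : ℝ) :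
    ‖duhamelMap f φ u t‖ ≤ M ∧ BddAE (M * rho n (max t 0)) (duhamelMap f φ u t) := by
  have hM0 := hM.pos
  have hK := h.pos
  have hI := rhoMass_nonneg n p
  have hL : 0 ≤ K * M ^ (p - 1) * M := by positivity
  have h2n : (1 : ℝ) ≤ 2 ^ (n + 1) := one_le_pow₀ (by norm_num)
  have hsm : 2 ^ (n + 1) * (K * M ^ (p - 1) * M) * rhoMass n p ≤ M / 4 := by
    have := mul_le_mul_of_nonneg_right hM.le hM0.le
    linarith
  have hsm1 : (K * M ^ (p - 1) * M) * rhoMass n p ≤ M / 4 :=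
    (mul_le_mul_of_nonneg_right (le_mul_of_one_le_left hL h2n) hI).trans hsm
  wlog ht : 0 ≤ t generalizing t
  · have h0 := this 0 le_rfl
    rw [max_eq_right le_rfl] at h0
    rwa [duhamelMap_of_nonpos (le_of_not_ge ht), max_eq_right (le_of_not_ge ht)]
  rw [duhamelMap, max_eq_left ht]
  have hρ := rho_pos (n := n) ht
  constructor
  · have a1 : ‖heat t φ‖ ≤ M / 4 := by
      refine (norm_heat_le _ _).trans (hφ1.trans ?_)
      have : (4 : ℝ) ≤ 2 ^ (n + 2) := by rw [pow_add]; linarith [one_le_pow₀ (n := n) (by norm_num : (1 : ℝ) ≤ 2)]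
      gcongr
    have a2 := norm_intervalIntegral_rho_le (F := fun s => heat (t - s) (nonlin f (u s))) hσ hL ht
      fun s hs _ => (norm_heat_le _ _).trans (hu.norm_nonlin_le h hs.le)
    calc _ ≤ _ := norm_add_le _ _
      _ ≤ M / 4 + M / 4 := add_le_add a1 (a2.trans hsm1)
      _ ≤ M := by linarith
  · have a1 : BddAE (2 ^ (n + 1) * (M / 2 ^ (n + 2)) * rho n t) (heat t φ) := by
      have := bddAE_heat_sub_time (b := M / 2 ^ (n + 2)) hφ1 le_rfl ht
        (hφ2.mono (by simp [rho]))
      rwa [sub_zero] at this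
    have a2 := bddAE_intervalIntegral_rho hσ (C := 2 ^ (n + 1) * (K * M ^ (p - 1) * M) * rho n t)
      (by positivity) ht (hu.intervalIntegrable h t le_rfl ht)
      fun s hs hst => hu.bddAE_heat_nonlin h hs.le hst
    refine (a1.add a2).mono ?_
    have e1 : 2 ^ (n + 1) * (M / 2 ^ (n + 2)) * rho n t = M / 2 * rho n t := by
      rw [pow_succ _ (n + 1)]; field_simp
    have e2 := mul_le_mul_of_nonneg_right hsm hρ.le
    rw [e1]
    nlinarith

theorem exists_decay_solution (h : PowerGrowth f K p) (hσ : 1 < (n : ℝ) / 2 * (p - 1)) {M : ℝ}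
    (hM : SmallRadius n K p M) {φ : L1 n} (hφ1 : ‖φ‖ ≤ M / 2 ^ (n + 2))
    (hφ2 : BddAE (M / 2 ^ (n + 2)) φ) :
    ∃ u : ℝ → L1 n, DecayBound M u ∧ ∀ t, 0 ≤ t →
      u t = heat t φ + ∫ s in (0 : ℝ)..t, heat (t - s) (nonlin f (u s)) := by
  have hM0 := hM.pos
  have hK := h.pos
  have hI := rhoMass_nonneg n p
  have mem := fun u : SolutionSpace n M =>
    duhamelMap_mem h hσ hM hφ1 hφ2 (SolutionSpace.decayBound hM0.le u.2)
  let Φ : SolutionSpace n M → SolutionSpace n M := fun u =>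
    ⟨BoundedContinuousFunction.ofNormedAddCommGroup (duhamelMap f φ u.1)
      (continuous_duhamelMap h φ hM0.le u.2) M fun t => (mem u t).1, fun t => mem u t⟩
  have hΦ : ContractingWith (1 / 2) Φ := by
    refine ⟨by rw [← NNReal.coe_lt_coe]; norm_num, LipschitzWith.of_dist_le_mul fun u v => ?_⟩
    rw [Subtype.dist_eq, Subtype.dist_eq]
    refine (BoundedContinuousFunction.dist_le (by positivity)).2 fun t => ?_
    change dist (duhamelMap f φ u.1 t) (duhamelMap f φ v.1 t) ≤ _
    have hu := SolutionSpace.decayBound hM0.le u.2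
    have hv := SolutionSpace.decayBound hM0.le v.2
    have ht : 0 ≤ max t 0 := le_max_right _ _
    rw [dist_eq_norm, duhamelMap, duhamelMap, add_sub_add_left_eq_sub,
      ← intervalIntegral.integral_sub (hu.intervalIntegrable h t le_rfl ht)
        (hv.intervalIntegrable h t le_rfl ht)]
    have hL : 0 ≤ 2 * K * M ^ (p - 1) * dist u.1 v.1 := by positivity
    refine (norm_intervalIntegral_rho_le hσ hL ht fun s hs _ => ?_).trans ?_
    · rw [← heat_sub]
      refine (norm_heat_le _ _).trans ((hu.norm_nonlin_sub_le hv h hs.le).trans ?_)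
      have hd : ‖u.1 s - v.1 s‖ ≤ dist u.1 v.1 := by
        rw [← dist_eq_norm]; exact BoundedContinuousFunction.dist_coe_le_dist s
      have hρ := rho_pos (n := n) hs.le
      calc _ ≤ 2 * K * M ^ (p - 1) * rho n s ^ (p - 1) * dist u.1 v.1 := by gcongr
        _ = _ := by ring
    · have h1 : (2 : ℝ) * (K * M ^ (p - 1)) * rhoMass n p ≤ 1 / 4 := by
        refine le_trans ?_ hM.le
        gcongr
        exact le_self_pow₀ (by norm_num) (by omega)
      have h2 := mul_le_mul_of_nonneg_right h1 (dist_nonneg (x := u.1) (y := v.1))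
      have h3 := dist_nonneg (x := u.1) (y := v.1)
      push_cast
      linarith
  have : CompleteSpace (SolutionSpace n M) := (isClosed_solutionSpace M).completeSpace_coe
  have : Nonempty (SolutionSpace n M) := by
    refine ⟨⟨0, fun t => ⟨by simpa using hM0.le, ?_⟩⟩⟩
    have hρ := rho_pos (n := n) (le_max_right t 0)
    filter_upwards [Lp.coeFn_zero ℝ 1 (volume : Measure (Rn n))] with x hx
    change |(0 : L1 n) x| ≤ _
    rw [hx]
    simp only [Pi.zero_apply, abs_zero]
    positivity
  refine ⟨hΦ.fixedPoint.1, SolutionSpace.decayBound hM0.le hΦ.fixedPoint.2, fun t ht => ?_⟩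
  have hfix : Φ hΦ.fixedPoint = hΦ.fixedPoint := hΦ.fixedPoint_isFixedPt
  have e : duhamelMap f φ hΦ.fixedPoint.1 t = hΦ.fixedPoint.1 t :=
    congrArg (fun u : SolutionSpace n M => u.1 t) hfix
  rw [← e, duhamelMap, max_eq_left ht]

end FixedPoint

theorem BddAE.eLpNorm_top_le {c : ℝ} {w : L1 n} (h : BddAE c w) :
    eLpNorm w ∞ volume ≤ ENNReal.ofReal c := by
  rw [eLpNorm_exponent_top]
  exact eLpNormEssSup_le_of_ae_bound h

theorem BddAE.memLp_top {c : ℝ} {w : L1 n} (h : BddAE c w) : MemLp w ∞ volume :=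
  ⟨Lp.aestronglyMeasurable w, h.eLpNorm_top_le.trans_lt ENNReal.ofReal_lt_top⟩

theorem bddAE_of_eLpNorm_top_le {c : ℝ} (hc : 0 ≤ c) {w : L1 n}
    (h : eLpNorm w ∞ volume ≤ ENNReal.ofReal c) : BddAE c w := by
  filter_upwards [enorm_ae_le_eLpNormEssSup w volume] with x hx
  rw [← eLpNorm_exponent_top] at hx
  have := hx.trans h
  rwa [← ofReal_norm, ENNReal.ofReal_le_ofReal_iff hc] at this

open Classical in
/-- The class in `L^∞` of an essentially bounded element of `L¹`. -/
noncomputable def toLInf (w : L1 n) : LInf n :=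
  if h : MemLp w ∞ volume then h.toLp _ else 0

theorem coeFn_toLInf {w : L1 n} (h : MemLp w ∞ volume) : toLInf w =ᵐ[volume] w := by
  rw [toLInf, dif_pos h]
  exact MemLp.coeFn_toLp _

theorem norm_LInf_le {v : LInf n} {c : ℝ} (hc : 0 ≤ c) (h : ∀ᵐ x, |v x| ≤ c) : ‖v‖ ≤ c := by
  rw [Lp.norm_def]
  refine ENNReal.toReal_le_of_le_ofReal hc ?_
  rw [eLpNorm_exponent_top]
  exact eLpNormEssSup_le_of_ae_bound h

theorem ae_le_norm_LInf (v : LInf n) : ∀ᵐ x, |v x| ≤ ‖v‖ := by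
  filter_upwards [enorm_ae_le_eLpNormEssSup v volume] with x hx
  rw [← eLpNorm_exponent_top] at hx
  rw [Lp.norm_def, ← Real.norm_eq_abs, ← toReal_enorm]
  exact ENNReal.toReal_mono (Lp.eLpNorm_ne_top v) hx

theorem norm_toLInf_sub_le {w v : L1 n} (hw : MemLp w ∞ volume) (hv : MemLp v ∞ volume) {d : ℝ}
    (hd : 0 ≤ d) (h : BddAE d (w - v)) : ‖toLInf w - toLInf v‖ ≤ d := by
  refine norm_LInf_le hd ?_
  filter_upwards [h, coeFn_toLInf hw, coeFn_toLInf hv, Lp.coeFn_sub w v,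
    Lp.coeFn_sub (toLInf w) (toLInf v)] with x h1 h2 h3 h4 h5
  rw [h5, Pi.sub_apply, h2, h3]
  rwa [h4, Pi.sub_apply] at h1

namespace DecayBound

variable {M : ℝ} {u : ℝ → L1 n} {φ : L1 n}

theorem bddAE_nonlin_const (hu : DecayBound M u) (h : PowerGrowth f K p) {s : ℝ} (hs : 0 ≤ s) :
    BddAE (K * M ^ (p - 1) * M) (nonlin f (u s)) :=
  h.bddAE_nonlin hu.nonneg (hu.bdd_const hs)

theorem sub_heat_eq (hu : DecayBound M u) (h : PowerGrowth f K p)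
    (hd : ∀ t, 0 ≤ t → u t = heat t φ + ∫ s in (0 : ℝ)..t, heat (t - s) (nonlin f (u s)))
    {δ t : ℝ} (hδ : 0 ≤ δ) (hδt : δ ≤ t) :
    u t - heat δ (u (t - δ)) = ∫ s in (t - δ)..t, heat (t - s) (nonlin f (u s)) := by
  have h0 : 0 ≤ t - δ := by linarith
  have e1 : heat δ (∫ s in (0 : ℝ)..(t - δ), heat (t - δ - s) (nonlin f (u s))) =
      ∫ s in (0 : ℝ)..(t - δ), heat (t - s) (nonlin f (u s)) := by
    rw [← heatCLM_apply, ← ContinuousLinearMap.intervalIntegral_comp_comm _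
      (hu.intervalIntegrable h (t - δ) le_rfl h0)]
    refine intervalIntegral.integral_congr fun s hs => ?_
    rw [uIcc_of_le h0] at hs
    simp only [heatCLM_apply]
    rw [heat_heat hδ (by linarith [hs.2])]
    congr 1; ring
  rw [hd t (by linarith), hd (t - δ) h0, heat_add_map, e1, heat_heat hδ h0,
    ← intervalIntegral.integral_add_adjacent_intervals
      (hu.intervalIntegrable h t le_rfl h0) (hu.intervalIntegrable h t h0 (by linarith)),
    add_sub_cancel]
  abel

theorem bddAE_sub_heat (hu : DecayBound M u) (h : PowerGrowth f K p)
    (hd : ∀ t, 0 ≤ t → u t = heat t φ + ∫ s in (0 : ℝ)..t, heat (t - s) (nonlin f (u s)))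
    {δ t : ℝ} (hδ : 0 ≤ δ) (hδt : δ ≤ t) :
    BddAE (K * M ^ (p - 1) * M * δ) (u t - heat δ (u (t - δ))) := by
  have h0 : 0 ≤ t - δ := by linarith
  rw [hu.sub_heat_eq h hd hδ hδt, intervalIntegral.integral_of_le (by linarith)]
  refine (BddAE.integral (g := fun _ => K * M ^ (p - 1) * M)
    ((intervalIntegrable_iff_integrableOn_Ioc_of_le (by linarith)).1
      (hu.intervalIntegrable h t h0 (by linarith)))
    (integrableOn_const (by simp)) ?_).mono ?_
  · exact (ae_restrict_mem measurableSet_Ioc).mono fun s hs =>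
      (hu.bddAE_nonlin_const h (h0.trans hs.1.le)).heat _
  · rw [setIntegral_const, Real.volume_real_Ioc_of_le (by linarith)]
    simp only [smul_eq_mul, sub_sub_cancel]
    linarith

theorem continuousOn_toLInf (hu : DecayBound M u) (h : PowerGrowth f K p)
    (hd : ∀ t, 0 ≤ t → u t = heat t φ + ∫ s in (0 : ℝ)..t, heat (t - s) (nonlin f (u s))) :
    ContinuousOn (fun t => toLInf (u t)) (Ioi 0) := by
  have hK := h.pos
  have hM := hu.nonneg
  rw [Metric.continuousOn_iff]
  intro t ht ε hε
  have ht : 0 < t := ht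
  set L := K * M ^ (p - 1) * M with hL
  have hL0 : 0 ≤ L := by positivity
  obtain ⟨δ, hδ0, hδt, hδL⟩ : ∃ δ, 0 < δ ∧ δ ≤ t / 2 ∧ L * δ ≤ ε / 8 := by
    refine ⟨min (t / 2) (ε / (8 * (L + 1))), by positivity, min_le_left _ _, ?_⟩
    calc L * min (t / 2) (ε / (8 * (L + 1))) ≤ L * (ε / (8 * (L + 1))) := by
          gcongr; exact min_le_right _ _
      _ = ε / 8 * (L / (L + 1)) := by field_simp
      _ ≤ ε / 8 * 1 := by
          gcongr; rw [div_le_one (by positivity)]; linarith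
      _ = _ := by ring
  set B := (4 * Real.pi * δ) ^ (-((n : ℝ) / 2)) with hB
  have hB0 : 0 < B := by positivity
  obtain ⟨η, hη0, hη⟩ := Metric.continuousOn_iff.1 hu.continuousOn (t - δ)
    (by simp only [mem_Ici]; linarith) (ε / (4 * B)) (by positivity)
  refine ⟨min η (t / 2), by positivity, fun s hs0 hst => ?_⟩
  have hs0 : 0 < s := hs0
  have h1 := hst.trans_le (min_le_left _ _)
  have h2 := hst.trans_le (min_le_right _ _)
  rw [Real.dist_eq, abs_lt] at h2
  have hδs : δ ≤ s := by linarith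
  have h3 := hη (s - δ) (by simp only [mem_Ici]; linarith)
    (by rw [Real.dist_eq] at h1 ⊢; rwa [sub_sub_sub_cancel_right])
  rw [dist_eq_norm] at h3 ⊢
  have b1 := hu.bddAE_sub_heat h hd hδ0.le hδs
  have b2 := hu.bddAE_sub_heat h hd hδ0.le (by linarith : δ ≤ t)
  have b3 := bddAE_heat hδ0 (u (s - δ) - u (t - δ))
  have b4 := (b1.sub b2).add b3
  rw [heat_sub] at b4
  have e : u s - heat δ (u (s - δ)) - (u t - heat δ (u (t - δ))) +
      (heat δ (u (s - δ)) - heat δ (u (t - δ))) = u s - u t := by abel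
  rw [e] at b4
  have b5 : B * ‖u (s - δ) - u (t - δ)‖ ≤ ε / 4 := by
    calc _ ≤ B * (ε / (4 * B)) := by gcongr
      _ = _ := by field_simp
  refine lt_of_le_of_lt (norm_toLInf_sub_le (hu.bdd_const hs0.le).memLp_top
    (hu.bdd_const ht.le).memLp_top (by positivity) (b4.mono (d := ε / 2) ?_)) (by linarith)
  linarith

theorem isGlobalSolution (hu : DecayBound M u) (h : PowerGrowth f K p)
    (hd : ∀ t, 0 ≤ t → u t = heat t φ + ∫ s in (0 : ℝ)..t, heat (t - s) (nonlin f (u s))) :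
    IsGlobalSolution f φ u where
  memX :=
    { continuousOn_L1 := hu.continuousOn
      bounded_L1 := ⟨M, hu.norm_le⟩
      LInf_part := by
        have hm := fun t (ht : 0 < t) => hu.bdd_const ht.le
        refine ⟨fun t => toLInf (u t), fun t ht => coeFn_toLInf (hm t ht).memLp_top,
          hu.continuousOn_toLInf h hd, M, fun t ht => norm_LInf_le hu.nonneg ?_⟩
        filter_upwards [hm t ht, coeFn_toLInf (hm t ht).memLp_top] with x h1 h2
        rwa [h2] }
  integrable t ht := hu.intervalIntegrable h t le_rfl ht
  duhamel := hd

end DecayBound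

/-- Interpolation between `L¹` and `L^∞` bounds at the scale of the heat equation. -/
theorem eLpNorm_interpolation {g : Rn n → ℝ} {A τ : ℝ} (hA : 0 < A) (hτ : 0 < τ)
    (h1 : eLpNorm g 1 volume ≤ ENNReal.ofReal A)
    (h2 : eLpNorm g ∞ volume ≤ ENNReal.ofReal (A * τ ^ (-((n : ℝ) / 2)))) {q : ℝ≥0∞}
    (hq : 1 ≤ q) :
    ENNReal.ofReal (τ ^ decayExp n q) * eLpNorm g q volume ≤ ENNReal.ofReal A := by
  have hq0 : q ≠ 0 := (zero_lt_one.trans_le hq).ne'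
  rcases eq_or_ne q ∞ with rfl | hq1
  · have e : decayExp n ∞ = (n : ℝ) / 2 := by simp [decayExp]
    rw [e]
    calc _ ≤ ENNReal.ofReal (τ ^ ((n : ℝ) / 2)) * ENNReal.ofReal (A * τ ^ (-((n : ℝ) / 2))) := by
          gcongr
      _ = _ := by
          rw [← ENNReal.ofReal_mul (by positivity)]
          congr 1
          rw [mul_left_comm, ← Real.rpow_add hτ]; simp
  · set r := q.toReal with hr
    have hr1 : 1 ≤ r := by
      rw [hr, ← ENNReal.toReal_one]; exact ENNReal.toReal_mono hq1 hq
    have e : decayExp n q = (n : ℝ) / 2 * (1 - 1 / r) := by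
      rw [decayExp, ENNReal.toReal_inv, one_div]
    set B := A * τ ^ (-((n : ℝ) / 2)) with hB
    have hB0 : 0 < B := by positivity
    have hae : ∀ᵐ x, ‖g x‖ₑ ≤ ENNReal.ofReal B := by
      filter_upwards [enorm_ae_le_eLpNormEssSup g volume] with x hx
      rw [← eLpNorm_exponent_top] at hx
      exact hx.trans h2
    have hint : ∫⁻ x, ‖g x‖ₑ ^ r ≤ ENNReal.ofReal (A * B ^ (r - 1)) := by
      calc ∫⁻ x, ‖g x‖ₑ ^ r ≤ ∫⁻ x, ‖g x‖ₑ * ENNReal.ofReal (B ^ (r - 1)) := by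
            refine lintegral_mono_ae (hae.mono fun x hx => ?_)
            have : ‖g x‖ₑ ^ r = ‖g x‖ₑ * ‖g x‖ₑ ^ (r - 1) := by
              nth_rw 2 [← ENNReal.rpow_one ‖g x‖ₑ]
              rw [← ENNReal.rpow_add_of_nonneg _ _ zero_le_one (by linarith)]
              congr 1; ring
            rw [this, ← ENNReal.ofReal_rpow_of_nonneg hB0.le (by linarith)]
            gcongr
        _ = eLpNorm g 1 volume * ENNReal.ofReal (B ^ (r - 1)) := by
            rw [lintegral_mul_const' _ _ ENNReal.ofReal_ne_top, eLpNorm_one_eq_lintegral_enorm]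
        _ ≤ ENNReal.ofReal A * ENNReal.ofReal (B ^ (r - 1)) := by gcongr
        _ = _ := (ENNReal.ofReal_mul hA.le).symm
    rw [eLpNorm_eq_lintegral_rpow_enorm_toReal hq0 hq1, e]
    calc _ ≤ ENNReal.ofReal (τ ^ ((n : ℝ) / 2 * (1 - 1 / r))) *
          ENNReal.ofReal (A * B ^ (r - 1)) ^ (1 / r) := by gcongr
      _ = ENNReal.ofReal (τ ^ ((n : ℝ) / 2 * (1 - 1 / r)) * (A * B ^ (r - 1)) ^ (1 / r)) := by
          rw [ENNReal.ofReal_rpow_of_nonneg (by positivity) (by positivity),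
            ← ENNReal.ofReal_mul (by positivity)]
      _ = _ := by
          congr 1
          have hr0 : r ≠ 0 := by linarith
          have e2 : A * B ^ (r - 1) = A ^ r * (τ ^ (-((n : ℝ) / 2))) ^ (r - 1) := by
            rw [hB, Real.mul_rpow hA.le (by positivity), ← mul_assoc, Real.rpow_sub_one hA.ne',
              mul_div_cancel₀ _ hA.ne']
          rw [e2, Real.mul_rpow (by positivity) (by positivity), ← Real.rpow_mul hA.le,
            mul_one_div_cancel hr0, Real.rpow_one, ← Real.rpow_mul hτ.le, ← Real.rpow_mul hτ.le,
            mul_left_comm, ← Real.rpow_add hτ]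
          have : (n : ℝ) / 2 * (1 - 1 / r) + -((n : ℝ) / 2) * (r - 1) * (1 / r) = 0 := by
            field_simp; ring
          rw [this, Real.rpow_zero, mul_one]

theorem eLpNorm_one_le {w : L1 n} {a : ℝ} (h : ‖w‖ ≤ a) :
    eLpNorm w 1 volume ≤ ENNReal.ofReal a := by
  rw [← ENNReal.ofReal_toReal (Lp.eLpNorm_ne_top w), ← Lp.norm_def]
  exact ENNReal.ofReal_le_ofReal h

theorem DecayBound.hasDecay {M : ℝ} {u : ℝ → L1 n} (hM : 0 < M) (hu : DecayBound M u) :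
    HasDecay u := by
  refine lt_of_le_of_lt ?_ (ENNReal.ofReal_lt_top (r := M))
  refine iSup₂_le fun q hq => iSup₂_le fun t ht => ?_
  have ht : 0 ≤ t := ht
  exact eLpNorm_interpolation hM (by linarith) (eLpNorm_one_le (hu.norm_le t ht))
    (hu.bdd t ht).eLpNorm_top_le hq.1

theorem le_two_mul_of_bootstrap {ι : Type*} [Nonempty ι] {r : ι → ℝ} {A : ℝ}
    (hb : BddAbove (range r)) (h : ∀ S, (∀ i, r i ≤ S) → ∀ i, r i ≤ A + S / 2) (i : ι) :
    r i ≤ 2 * A := by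
  have h1 := ciSup_le (h _ (le_ciSup hb))
  linarith [le_ciSup hb i]

theorem MemX.exists_bddAE {u : ℝ → L1 n} (hu : MemX u) : ∃ c, 0 ≤ c ∧ ∀ t, 0 < t → BddAE c (u t) := by
  obtain ⟨v, hv, -, M, hM⟩ := hu.LInf_part
  refine ⟨max M 0, le_max_right _ _, fun t ht => ?_⟩
  filter_upwards [hv t ht, ae_le_norm_LInf (v t)] with x h1 h2
  rw [← h1]
  exact h2.trans ((hM t ht).trans (le_max_left _ _))

theorem IsGlobalSolution.unique (h : PowerGrowth f K p) {φ : L1 n} {u v : ℝ → L1 n}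
    (hu : IsGlobalSolution f φ u) (hv : IsGlobalSolution f φ v) {t : ℝ} (ht : 0 ≤ t) :
    u t = v t := by
  have hK := h.pos
  obtain ⟨c₁, hc₁, hcu⟩ := hu.memX.exists_bddAE
  obtain ⟨c₂, hc₂, hcv⟩ := hv.memX.exists_bddAE
  obtain ⟨M₁, hM₁⟩ := hu.memX.bounded_L1
  obtain ⟨M₂, hM₂⟩ := hv.memX.bounded_L1
  set c := max c₁ c₂
  have hc : 0 ≤ c := hc₁.trans (le_max_left _ _)
  set L := 2 * K * c ^ (p - 1) with hL
  have hL0 : 0 ≤ L := by positivity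
  set ℓ := 2 * L + 1 with hℓ
  have hℓ0 : 0 < ℓ := by positivity
  have key := le_two_mul_of_bootstrap (ι := Ici (0 : ℝ)) (A := 0)
    (r := fun t => Real.exp (-(ℓ * t)) * ‖u t - v t‖) ?_ ?_ ⟨t, ht⟩
  · simp only [mul_zero] at key
    have h0 : ‖u t - v t‖ ≤ 0 := nonpos_of_mul_nonpos_right key (Real.exp_pos _)
    exact sub_eq_zero.1 (norm_le_zero_iff.1 h0)
  · refine ⟨M₁ + M₂, ?_⟩
    rintro _ ⟨⟨t, ht⟩, rfl⟩
    have ht : 0 ≤ t := ht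
    have h1 : Real.exp (-(ℓ * t)) ≤ 1 :=
      Real.exp_le_one_iff.2 (by have : 0 ≤ ℓ * t := by positivity
                                linarith)
    calc _ ≤ ‖u t - v t‖ := mul_le_of_le_one_left (norm_nonneg _) h1
      _ ≤ ‖u t‖ + ‖v t‖ := norm_sub_le _ _
      _ ≤ _ := add_le_add (hM₁ t ht) (hM₂ t ht)
  · rintro S hS ⟨t, ht⟩
    have ht : 0 ≤ t := ht
    have hS0 : 0 ≤ S := le_trans (by positivity) (hS ⟨t, ht⟩)
    have hexp : Continuous fun s => L * S * Real.exp (ℓ * s) := by fun_prop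
    have hint : ‖u t - v t‖ ≤ ∫ s in (0 : ℝ)..t, L * S * Real.exp (ℓ * s) := by
      rw [hu.duhamel t ht, hv.duhamel t ht, add_sub_add_left_eq_sub,
        ← intervalIntegral.integral_sub (hu.integrable t ht) (hv.integrable t ht)]
      refine intervalIntegral.norm_integral_le_of_norm_le ht (ae_of_all _ fun s hs => ?_)
        (hexp.intervalIntegrable _ _)
      rw [← heat_sub]
      refine (norm_heat_le _ _).trans ((h.norm_nonlin_sub_le
        ((hcu s hs.1).mono (le_max_left _ _)) ((hcv s hs.1).mono (le_max_right _ _))).trans ?_)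
      have h2 := hS ⟨s, hs.1.le⟩
      simp only at h2
      rw [Real.exp_neg, inv_mul_le_iff₀ (Real.exp_pos _)] at h2
      rw [mul_assoc L S]
      gcongr
      linarith
    have hval : ∫ s in (0 : ℝ)..t, L * S * Real.exp (ℓ * s) =
        L * S * (ℓ⁻¹ * (Real.exp (ℓ * t) - 1)) := by
      rw [intervalIntegral.integral_const_mul,
        intervalIntegral.integral_comp_mul_left (fun x => Real.exp x) hℓ0.ne', integral_exp]
      simp
    rw [hval] at hint
    have h3 : L * ℓ⁻¹ ≤ 1 / 2 := by
      rw [← div_eq_mul_inv, div_le_div_iff₀ hℓ0 (by norm_num)]; linarith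
    simp only
    rw [Real.exp_neg, inv_mul_le_iff₀ (Real.exp_pos _)]
    have hE := Real.exp_pos (ℓ * t)
    calc _ ≤ _ := hint
      _ ≤ L * S * (ℓ⁻¹ * Real.exp (ℓ * t)) := by gcongr; linarith
      _ = L * ℓ⁻¹ * (S * Real.exp (ℓ * t)) := by ring
      _ ≤ 1 / 2 * (S * Real.exp (ℓ * t)) := by gcongr
      _ = _ := by ring

/-- The weight `|x|^k` truncated at height `N`. -/
noncomputable def truncWeight (k N : ℕ) (x : Rn n) : ℝ := min (‖x‖ ^ k) N

theorem continuous_truncWeight (k N : ℕ) : Continuous (truncWeight (n := n) k N) := by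
  unfold truncWeight; fun_prop

theorem truncWeight_nonneg (k N : ℕ) (x : Rn n) : 0 ≤ truncWeight k N x :=
  le_min (by positivity) (by positivity)

theorem abs_truncWeight_le (k N : ℕ) (x : Rn n) : |truncWeight k N x| ≤ N := by
  rw [abs_of_nonneg (truncWeight_nonneg k N x)]
  exact min_le_right _ _

/-- Multiplication by the truncated weight. -/
noncomputable def truncMul (n k N : ℕ) : L1 n →L[ℝ] L1 n :=
  weightMul (continuous_truncWeight k N) (abs_truncWeight_le k N)

theorem norm_truncMul (k N : ℕ) (w : L1 n) :
    ‖truncMul n k N w‖ = ∫ x, truncWeight k N x * |w x| := by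
  rw [truncMul, norm_weightMul]
  simp only [abs_of_nonneg (truncWeight_nonneg k N _)]

theorem integrable_truncWeight_mul (k N : ℕ) (w : L1 n) :
    Integrable fun x => truncWeight k N x * |w x| :=
  (memLp_one_iff_integrable.1 (memLp_weight_mul (continuous_truncWeight k N)
    (abs_truncWeight_le k N) w)).abs.congr (ae_of_all _ fun x => by
      simp only [abs_mul, abs_of_nonneg (truncWeight_nonneg k N _)])

theorem norm_pow_le_add {k : ℕ} (hk : k = 1 ∨ k = 2) (x y : Rn n) :
    ‖x‖ ^ k ≤ 2 * ‖x - y‖ ^ k + 2 * ‖y‖ ^ k := by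
  have h1 : ‖x‖ ≤ ‖x - y‖ + ‖y‖ := by simpa using norm_add_le (x - y) y
  have h2 := norm_nonneg (x - y)
  have h3 := norm_nonneg y
  rcases hk with rfl | rfl
  · simp only [pow_one]; linarith
  · calc ‖x‖ ^ 2 ≤ (‖x - y‖ + ‖y‖) ^ 2 := by gcongr
      _ ≤ _ := by nlinarith [sq_nonneg (‖x - y‖ - ‖y‖)]

theorem truncWeight_le_add {k : ℕ} (hk : k = 1 ∨ k = 2) (N : ℕ) (x y : Rn n) :
    truncWeight k N x ≤ 2 * ‖x - y‖ ^ k + 2 * truncWeight k N y := by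
  unfold truncWeight
  rcases le_total (‖y‖ ^ k) (N : ℝ) with h | h
  · rw [min_eq_left h]
    exact (min_le_left _ _).trans (norm_pow_le_add hk x y)
  · rw [min_eq_right h]
    refine (min_le_right _ _).trans ?_
    have : 0 ≤ ‖x - y‖ ^ k := by positivity
    have : (0 : ℝ) ≤ N := by positivity
    linarith

theorem norm_pow_le_sqrt_pow_mul {k : ℕ} (hk : k = 1 ∨ k = 2) {t : ℝ} (ht : 0 < t) (x : Rn n) :
    ‖x‖ ^ k ≤ √t ^ k * (1 + ‖x‖ ^ 2 / t) := by
  have hs : 0 < √t := Real.sqrt_pos.2 ht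
  have e : ‖x‖ ^ 2 / t = (‖x‖ / √t) ^ 2 := by rw [div_pow, Real.sq_sqrt ht.le]
  have e2 : ‖x‖ ^ k = √t ^ k * (‖x‖ / √t) ^ k := by rw [← mul_pow, mul_div_cancel₀ _ hs.ne']
  rw [e, e2]
  gcongr
  rcases hk with rfl | rfl
  · nlinarith [sq_nonneg (‖x‖ / √t - 1), sq_nonneg (‖x‖ / √t)]
  · linarith

theorem norm_truncMul_heat_le {k : ℕ} (hk : k = 1 ∨ k = 2) (N : ℕ) {t : ℝ} (ht : 0 ≤ t)
    (w : L1 n) : ‖truncMul n k N (heat t w)‖ ≤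
      2 * ‖truncMul n k N w‖ + 2 * domConst n * √t ^ k * ‖w‖ := by
  have hD := one_le_domConst n
  rcases ht.eq_or_lt with rfl | ht
  · rw [heat_of_nonpos le_rfl]
    have h1 := norm_nonneg (truncMul n k N w)
    have h2 : 0 ≤ 2 * domConst n * √0 ^ k * ‖w‖ := by positivity
    linarith
  have hw := (L1.integrable_coeFn w).abs
  have hWw := integrable_truncWeight_mul k N w
  have h2t : 0 < 2 * t := by positivity
  have hst : 0 ≤ √t ^ k := by positivity
  have point : ∀ x, truncWeight k N x * gaussConv t (fun y => |w y|) x ≤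
      2 * gaussConv t (fun y => truncWeight k N y * |w y|) x +
        2 * domConst n * √t ^ k * gaussConv (2 * t) (fun y => |w y|) x := by
    intro x
    simp only [gaussConv, ← integral_const_mul]
    rw [← integral_add ((integrable_gaussKernel_mul ht hWw x).const_mul _)
      ((integrable_gaussKernel_mul h2t hw x).const_mul _)]
    refine integral_mono ((integrable_gaussKernel_mul ht hw x).const_mul _)
      (((integrable_gaussKernel_mul ht hWw x).const_mul _).add
        ((integrable_gaussKernel_mul h2t hw x).const_mul _)) fun y => ?_
    have hg := gaussKernel_nonneg ht (x - y)
    have ha := abs_nonneg (w y)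
    have h1 := truncWeight_le_add hk N x y
    have h2 := norm_pow_le_sqrt_pow_mul hk ht (x - y)
    have h3 := quadratic_mul_gaussKernel_le ht (x - y)
    have h4 : ‖x - y‖ ^ k * gaussKernel n t (x - y) ≤
        √t ^ k * (domConst n * gaussKernel n (2 * t) (x - y)) :=
      calc _ ≤ √t ^ k * (1 + ‖x - y‖ ^ 2 / t) * gaussKernel n t (x - y) := by gcongr
        _ = √t ^ k * ((1 + ‖x - y‖ ^ 2 / t) * gaussKernel n t (x - y)) := by ring
        _ ≤ _ := by gcongr
    calc truncWeight k N x * (gaussKernel n t (x - y) * |w y|)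
        ≤ (2 * ‖x - y‖ ^ k + 2 * truncWeight k N y) * (gaussKernel n t (x - y) * |w y|) := by
          gcongr
      _ = 2 * (gaussKernel n t (x - y) * (truncWeight k N y * |w y|)) +
          2 * (‖x - y‖ ^ k * gaussKernel n t (x - y)) * |w y| := by ring
      _ ≤ 2 * (gaussKernel n t (x - y) * (truncWeight k N y * |w y|)) +
          2 * (√t ^ k * (domConst n * gaussKernel n (2 * t) (x - y))) * |w y| := by gcongr
      _ = _ := by ring
  rw [norm_truncMul, norm_truncMul, L1.norm_eq_integral_norm]
  simp only [Real.norm_eq_abs]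
  rw [← integral_gaussConv ht hWw, ← integral_gaussConv h2t hw, ← integral_const_mul,
    ← integral_const_mul, ← integral_add ((integrable_gaussConv ht hWw).const_mul _)
      ((integrable_gaussConv h2t hw).const_mul _)]
  refine integral_mono_ae (integrable_truncWeight_mul k N _)
    (((integrable_gaussConv ht hWw).const_mul _).add
      ((integrable_gaussConv h2t hw).const_mul _)) ?_
  filter_upwards [coeFn_heat ht w] with x hx
  rw [hx]
  refine le_trans ?_ (point x)
  exact mul_le_mul_of_nonneg_left (abs_gaussConv_le ht _ x) (truncWeight_nonneg k N x)

theorem integrable_norm_pow_mul {k : ℕ} {w : L1 n} {C : ℝ} (h : ∀ N, ‖truncMul n k N w‖ ≤ C) :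
    Integrable fun x => ‖x‖ ^ k * |w x| := by
  have hcont : Continuous fun x : Rn n => ‖x‖ ^ k := by fun_prop
  refine ⟨hcont.aestronglyMeasurable.mul (L1.integrable_coeFn w).abs.1, ?_⟩
  rw [hasFiniteIntegral_iff_ofReal (ae_of_all _ fun x => by positivity)]
  refine lt_of_le_of_lt ?_ (ENNReal.ofReal_lt_top (r := C))
  refine le_of_tendsto' (lintegral_tendsto_of_tendsto_of_monotone
    (f := fun (N : ℕ) x => ENNReal.ofReal (truncWeight k N x * |w x|)) (fun N => ?_)
    (ae_of_all _ fun x N N' hN => ?_) (ae_of_all _ fun x => ?_)) fun N => ?_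
  · exact (integrable_truncWeight_mul k N w).1.aemeasurable.ennreal_ofReal
  · refine ENNReal.ofReal_le_ofReal ?_
    unfold truncWeight
    gcongr
  · refine tendsto_const_nhds.congr' ?_
    filter_upwards [Filter.eventually_ge_atTop ⌈‖x‖ ^ k⌉₊] with N hN
    rw [truncWeight, min_eq_left (Nat.ceil_le.1 hN)]
  · rw [← ofReal_integral_eq_lintegral_ofReal (integrable_truncWeight_mul k N w)
      (ae_of_all _ fun x => mul_nonneg (truncWeight_nonneg k N x) (abs_nonneg _)), ← norm_truncMul]
    exact ENNReal.ofReal_le_ofReal (h N)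

theorem norm_truncMul_le_integral {k : ℕ} {w : L1 n} (h : Integrable fun x => ‖x‖ ^ k * |w x|)
    (N : ℕ) : ‖truncMul n k N w‖ ≤ ∫ x, ‖x‖ ^ k * |w x| := by
  rw [norm_truncMul]
  refine integral_mono (integrable_truncWeight_mul k N w) h fun x => ?_
  exact mul_le_mul_of_nonneg_right (min_le_left _ _) (abs_nonneg _)

theorem MemWeightedL1.integrable_norm_pow_mul {k : ℕ} (hk : k = 1 ∨ k = 2) {φ : L1 n}
    (h : MemWeightedL1 k φ) : Integrable fun x => ‖x‖ ^ k * |φ x| := by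
  have hi : ∀ i : Fin n, Integrable fun x : Rn n => |x i| ^ k * |φ x| := by
    intro i
    have := h.2 (Pi.single i k) (by simp)
    refine this.abs.congr (ae_of_all _ fun x => ?_)
    have e : ∏ j, x j ^ (Pi.single i k : Fin n → ℕ) j = x i ^ k := by
      rw [Finset.prod_eq_single i]
      · simp
      · intro j _ hj; simp [hj]
      · simp
    simp only [e, abs_mul, abs_pow]
  have hsum : Integrable fun x : Rn n => ∑ i, |x i| ^ k * |φ x| :=
    integrable_finsetSum _ fun i _ => hi i
  have hcont : Continuous fun x : Rn n => ‖x‖ ^ k := by fun_prop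
  refine hsum.mono' (hcont.aestronglyMeasurable.mul (L1.integrable_coeFn φ).abs.1)
    (ae_of_all _ fun x => ?_)
  rw [Real.norm_of_nonneg (by positivity), ← Finset.sum_mul]
  gcongr
  have hsq : ‖x‖ ^ 2 = ∑ i, |x i| ^ 2 := by
    rw [EuclideanSpace.norm_sq_eq]; rfl
  rcases hk with rfl | rfl
  · simp only [pow_one]
    refine le_of_sq_le_sq ?_ (Finset.sum_nonneg fun i _ => abs_nonneg _)
    rw [hsq]
    exact Finset.sum_sq_le_sq_sum_of_nonneg fun i _ => abs_nonneg _
  · exact hsq.le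

theorem integrableOn_sqrt_pow_mul_rho {k : ℕ} (h : (k : ℝ) / 2 + 1 < (n : ℝ) / 2 * (p - 1)) :
    IntegrableOn (fun s => √(1 + s) ^ k * rho n s ^ (p - 1)) (Ioi 0) := by
  refine (integrableOn_add_rpow_Ioi_of_lt (a := (k : ℝ) / 2 - (n : ℝ) / 2 * (p - 1)) (c := 0)
    (m := 1) (by linarith) (by norm_num)).congr_fun (fun s hs => ?_) measurableSet_Ioi
  have hs : 0 < s := hs
  simp only
  rw [rho_rpow hs.le, Real.sqrt_eq_rpow, ← Real.rpow_natCast, ← Real.rpow_mul (by positivity),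
    add_comm 1 s, ← Real.rpow_add (by positivity)]
  congr 1; ring

theorem SmallRadius.le_quarter {M : ℝ} (hM : SmallRadius n K p M) (hK : 0 < K) :
    2 * (K * M ^ (p - 1)) * rhoMass n p ≤ 1 / 4 := by
  have hM0 := hM.pos
  have hI := rhoMass_nonneg n p
  refine le_trans ?_ hM.le
  gcongr
  exact le_self_pow₀ (by norm_num) (by omega)

namespace DecayBound

variable {M : ℝ} {u : ℝ → L1 n} {φ : L1 n}

theorem norm_truncMul_nonlin_le (hu : DecayBound M u) (h : PowerGrowth f K p) {s : ℝ} (hs : 0 ≤ s)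
    (k N : ℕ) : ‖truncMul n k N (nonlin f (u s))‖ ≤
      K * M ^ (p - 1) * rho n s ^ (p - 1) * ‖truncMul n k N (u s)‖ :=
  hu.norm_weightMul_nonlin_le h hs _ _

/-- Growth of the truncated moments of a decaying solution, uniformly in the truncation. -/
theorem norm_truncMul_le (hu : DecayBound M u) (h : PowerGrowth f K p)
    (hσ : 1 < (n : ℝ) / 2 * (p - 1)) (hM : SmallRadius n K p M)
    (hd : ∀ t, 0 ≤ t → u t = heat t φ + ∫ s in (0 : ℝ)..t, heat (t - s) (nonlin f (u s)))
    {k : ℕ} (hk : k = 1 ∨ k = 2) {N : ℕ} {A : ℝ} (hA : ‖truncMul n k N φ‖ ≤ A) {t : ℝ}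
    (ht : 0 ≤ t) :
    ‖truncMul n k N (u t)‖ ≤ 2 * (2 * A + 3 * domConst n * M) * √(1 + t) ^ k := by
  have hK := h.pos
  have hM0 := hM.pos
  have hD := one_le_domConst n
  have hI := rhoMass_nonneg n p
  have hA0 : 0 ≤ A := (norm_nonneg _).trans hA
  have hφ : ‖φ‖ ≤ M := by
    have h1 := hu.norm_le 0 le_rfl
    rwa [hd 0 le_rfl, intervalIntegral.integral_same, add_zero, heat_of_nonpos le_rfl] at h1
  have hg : ∀ t : ℝ, 0 ≤ t → 1 ≤ √(1 + t) ^ k := fun t ht =>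
    one_le_pow₀ (Real.one_le_sqrt.2 (by linarith))
  have key := le_two_mul_of_bootstrap (ι := Ici (0 : ℝ)) (A := 2 * A + 3 * domConst n * M)
    (r := fun t => ‖truncMul n k N (u t)‖ / √(1 + t) ^ k) ?_ ?_ ⟨t, ht⟩
  · simp only at key
    rwa [div_le_iff₀ (zero_lt_one.trans_le (hg t ht))] at key
  · refine ⟨‖truncMul n k N‖ * M, ?_⟩
    rintro _ ⟨⟨t, ht⟩, rfl⟩
    calc _ ≤ ‖truncMul n k N (u t)‖ := div_le_self (norm_nonneg _) (hg t ht)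
      _ ≤ ‖truncMul n k N‖ * ‖u t‖ := (truncMul n k N).le_opNorm _
      _ ≤ _ := by gcongr; exact hu.norm_le t ht
  · rintro S hS ⟨t, ht⟩
    have ht : 0 ≤ t := ht
    have hS0 : 0 ≤ S := le_trans (by positivity) (hS ⟨t, ht⟩)
    set G := √(1 + t) ^ k with hG
    have hG1 : 1 ≤ G := hg t ht
    have hsq : ∀ τ, τ ≤ t → √τ ^ k ≤ G := fun τ hτ => by
      rw [hG]; gcongr; linarith
    have hC : 0 ≤ 2 * (K * M ^ (p - 1)) * (S * G) +
        2 * domConst n * G * (K * M ^ (p - 1) * M) := by positivity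
    have h1 : ‖truncMul n k N (heat t φ)‖ ≤ 2 * A + 2 * domConst n * G * M := by
      refine (norm_truncMul_heat_le hk N ht φ).trans ?_
      have := hsq t le_rfl
      gcongr
    have h2 : ‖truncMul n k N (∫ s in (0 : ℝ)..t, heat (t - s) (nonlin f (u s)))‖ ≤
        (2 * (K * M ^ (p - 1)) * (S * G) + 2 * domConst n * G * (K * M ^ (p - 1) * M)) *
          rhoMass n p := by
      rw [← ContinuousLinearMap.intervalIntegral_comp_comm _
        (hu.intervalIntegrable h t le_rfl ht)]
      refine norm_intervalIntegral_rho_le hσ hC ht fun s hs hst => ?_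
      refine (norm_truncMul_heat_le hk N (sub_nonneg.2 hst) _).trans ?_
      have hρ := rho_pos (n := n) hs.le
      have b1 := hu.norm_truncMul_nonlin_le h hs.le k N
      have b2 := hu.norm_nonlin_le h hs.le
      have b3 := hsq (t - s) (by linarith)
      have b4 : ‖truncMul n k N (u s)‖ ≤ S * G := by
        have := hS ⟨s, hs.le⟩
        simp only at this
        rw [div_le_iff₀ (zero_lt_one.trans_le (hg s hs.le))] at this
        refine this.trans ?_
        rw [hG]; gcongr
      calc _ ≤ 2 * (K * M ^ (p - 1) * rho n s ^ (p - 1) * (S * G)) +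
            2 * domConst n * G * (K * M ^ (p - 1) * M * rho n s ^ (p - 1)) := by
            have b5 := b1.trans (mul_le_mul_of_nonneg_left b4 (by positivity))
            gcongr
        _ = _ := by ring
    have hsm := hM.le_quarter hK
    have h3 := mul_le_mul_of_nonneg_right hsm (by positivity : 0 ≤ S * G)
    have h4 := mul_le_mul_of_nonneg_right hsm (by positivity : 0 ≤ domConst n * G * M)
    simp only
    rw [div_le_iff₀ (by positivity), hd t ht, map_add]
    refine (norm_add_le _ _).trans ((add_le_add h1 h2).trans ?_)
    have h5 : A ≤ A * G := le_mul_of_one_le_right hA0 hG1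
    have h6 : 0 ≤ S * G := by positivity
    have h7 : 0 ≤ domConst n * G * M := by positivity
    nlinarith

theorem integrableOn_nonlin (hu : DecayBound M u) (h : PowerGrowth f K p)
    (hσ : 1 < (n : ℝ) / 2 * (p - 1)) : IntegrableOn (fun s => nonlin f (u s)) (Ioi 0) := by
  refine ((integrableOn_rho_rpow hσ).const_mul (K * M ^ (p - 1) * M)).mono'
    (((hu.continuousOn_nonlin h).mono Ioi_subset_Ici_self).aestronglyMeasurable
      measurableSet_Ioi) ?_
  exact (ae_restrict_mem measurableSet_Ioi).mono fun s hs => hu.norm_nonlin_le h (le_of_lt hs)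

theorem integrable_norm_pow_mul_phi1 (hu : DecayBound M u) (h : PowerGrowth f K p)
    (hM : SmallRadius n K p M)
    (hd : ∀ t, 0 ≤ t → u t = heat t φ + ∫ s in (0 : ℝ)..t, heat (t - s) (nonlin f (u s)))
    {k : ℕ} (hk : k = 1 ∨ k = 2) (hσ : (k : ℝ) / 2 + 1 < (n : ℝ) / 2 * (p - 1))
    (hφ : Integrable fun x => ‖x‖ ^ k * |φ x|) :
    Integrable fun x => ‖x‖ ^ k * |phi1 f φ u x| := by
  have hK := h.pos
  have hM0 := hM.pos
  have hσ' : 1 < (n : ℝ) / 2 * (p - 1) := by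
    have : (0 : ℝ) ≤ (k : ℝ) / 2 := by positivity
    linarith
  set A := ∫ x, ‖x‖ ^ k * |φ x| with hA
  set B := 2 * (2 * A + 3 * domConst n * M) with hB
  refine integrable_norm_pow_mul (C := A + ∫ s in Ioi (0 : ℝ), K * M ^ (p - 1) * B *
    (√(1 + s) ^ k * rho n s ^ (p - 1))) fun N => ?_
  have h1 := norm_truncMul_le_integral hφ N
  rw [phi1, map_add]
  refine (norm_add_le _ _).trans (add_le_add h1 ?_)
  rw [← ContinuousLinearMap.integral_comp_comm _ (hu.integrableOn_nonlin h hσ')]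
  refine norm_integral_le_of_norm_le ((integrableOn_sqrt_pow_mul_rho hσ).const_mul _) ?_
  refine (ae_restrict_mem measurableSet_Ioi).mono fun s hs => ?_
  have hs : 0 < s := hs
  have hρ := rho_pos (n := n) hs.le
  refine (hu.norm_truncMul_nonlin_le h hs.le k N).trans ?_
  have h2 := hu.norm_truncMul_le h hσ' hM hd hk h1 hs.le
  calc _ ≤ K * M ^ (p - 1) * rho n s ^ (p - 1) * (B * √(1 + s) ^ k) := by gcongr
    _ = _ := by ring

end DecayBound

/-- The constant in the time regularity estimates of the heat semigroup. -/
noncomputable def timeConst (n : ℕ) : ℝ := 2 ^ (n + 3) * domConst n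

theorem two_pow_le_timeConst (n : ℕ) : 2 ^ (n + 3) ≤ timeConst n :=
  le_mul_of_one_le_right (by positivity) (one_le_domConst n)

theorem rpow_gauss_le {t : ℝ} (ht : 0 < t) :
    (4 * Real.pi * (2 * t)) ^ (-((n : ℝ) / 2)) ≤ t ^ (-((n : ℝ) / 2)) := by
  refine Real.rpow_le_rpow_of_nonpos ht ?_
    (by have : (0 : ℝ) ≤ n := by positivity
        linarith)
  nlinarith [Real.pi_gt_three]

theorem rho_le_rpow {t : ℝ} (ht : 0 < t) : rho n t ≤ t ^ (-((n : ℝ) / 2)) :=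
  Real.rpow_le_rpow_of_nonpos ht (by linarith)
    (by have : (0 : ℝ) ≤ n := by positivity
        linarith)

theorem abs_gaussConv_time_sub_le {t τ : ℝ} (ht : 0 < t) (h1 : t / 2 ≤ τ) (h2 : τ ≤ t)
    {h : Rn n → ℝ} (hh : Integrable h) (x : Rn n) :
    |gaussConv τ h x - gaussConv t h x| ≤
      2 ^ (n + 1) * domConst n * ((t - τ) / t) * gaussConv (2 * t) (fun y => |h y|) x := by
  have hτ : 0 < τ := by linarith
  simp only [gaussConv]
  rw [← integral_sub (integrable_gaussKernel_mul hτ hh x) (integrable_gaussKernel_mul ht hh x),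
    ← integral_const_mul, ← Real.norm_eq_abs]
  refine norm_integral_le_of_norm_le
    ((integrable_gaussKernel_mul (by positivity) hh.abs x).const_mul _) (ae_of_all _ fun y => ?_)
  rw [← sub_mul, norm_mul, Real.norm_eq_abs, Real.norm_eq_abs, ← mul_assoc]
  gcongr
  exact abs_gaussKernel_time_sub_le ht h1 h2 (x - y)

theorem norm_heat_time_sub_le {t τ : ℝ} (ht : 0 < t) (h1 : t / 2 ≤ τ) (h2 : τ ≤ t) (w : L1 n) :
    ‖heat τ w - heat t w‖ ≤ 2 ^ (n + 1) * domConst n * ((t - τ) / t) * ‖w‖ := by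
  have hτ : 0 < τ := by linarith
  have h2t : 0 < 2 * t := by linarith
  have hw := L1.integrable_coeFn w
  rw [L1.norm_eq_integral_norm, L1.norm_eq_integral_norm]
  simp only [Real.norm_eq_abs]
  rw [← integral_gaussConv h2t hw.abs, ← integral_const_mul]
  refine integral_mono_ae (L1.integrable_coeFn _).abs
    ((integrable_gaussConv h2t hw.abs).const_mul _) ?_
  filter_upwards [Lp.coeFn_sub (heat τ w) (heat t w), coeFn_heat hτ w, coeFn_heat ht w]
    with x e1 e2 e3
  rw [e1, Pi.sub_apply, e2, e3]
  exact abs_gaussConv_time_sub_le ht h1 h2 hw x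

theorem bddAE_heat_time_sub {t τ : ℝ} (ht : 0 < t) (h1 : t / 2 ≤ τ) (h2 : τ ≤ t) (w : L1 n) :
    BddAE (2 ^ (n + 1) * domConst n * ((t - τ) / t) * ‖w‖ * t ^ (-((n : ℝ) / 2)))
      (heat τ w - heat t w) := by
  have hτ : 0 < τ := by linarith
  have h2t : 0 < 2 * t := by linarith
  have hw := L1.integrable_coeFn w
  have hD := one_le_domConst n
  filter_upwards [Lp.coeFn_sub (heat τ w) (heat t w), coeFn_heat hτ w, coeFn_heat ht w]
    with x e1 e2 e3
  rw [e1, Pi.sub_apply, e2, e3, mul_assoc _ ‖w‖]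
  refine (abs_gaussConv_time_sub_le ht h1 h2 hw x).trans ?_
  have hq : 0 ≤ (t - τ) / t := div_nonneg (by linarith) ht.le
  gcongr
  refine (gaussConv_le h2t hw.abs (fun _ => abs_nonneg _) x).trans ?_
  rw [L1.norm_eq_integral_norm, mul_comm]
  exact mul_le_mul_of_nonneg_left (rpow_gauss_le ht) (integral_nonneg fun _ => abs_nonneg _)

theorem heat_time_sub_bounds {k : ℕ} (hk : k = 1 ∨ k = 2) {w : L1 n} {b s t : ℝ} (hb : ‖w‖ ≤ b)
    (hs : 0 < s) (hst : s ≤ t) (hw : BddAE (b * rho n s) w) :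
    ‖heat (t - s) w - heat t w‖ ≤ timeConst n * b * (√s ^ k / √t ^ k) ∧
      BddAE (timeConst n * b * (√s ^ k / √t ^ k) * t ^ (-((n : ℝ) / 2)))
        (heat (t - s) w - heat t w) := by
  have ht : 0 < t := hs.trans_le hst
  have hb0 : 0 ≤ b := (norm_nonneg _).trans hb
  have hD := one_le_domConst n
  have hT := two_pow_le_timeConst n
  have h2n : (1 : ℝ) ≤ 2 ^ n := one_le_pow₀ (by norm_num)
  have ht0 : 0 < t ^ (-((n : ℝ) / 2)) := by positivity
  have hr0 : 0 ≤ s / t := by positivity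
  have hr1 : s / t ≤ 1 := (div_le_one ht).2 hst
  have er : √s ^ k / √t ^ k = √(s / t) ^ k := by rw [← div_pow, Real.sqrt_div hs.le]
  have hsr : s / t ≤ √(s / t) ^ k := by
    have h1 : √(s / t) ≤ 1 := Real.sqrt_le_one.2 hr1
    calc s / t = √(s / t) ^ 2 := (Real.sq_sqrt hr0).symm
      _ ≤ √(s / t) ^ k :=
        pow_le_pow_of_le_one (Real.sqrt_nonneg _) h1 (by omega)
  rw [er]
  set q := √(s / t) ^ k
  have hq0 : 0 ≤ q := by positivity
  rcases le_total s (t / 2) with h | h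
  · have hc : 2 ^ (n + 1) * domConst n * ((t - (t - s)) / t) * ‖w‖ ≤ timeConst n * b * q := by
      rw [sub_sub_cancel, timeConst]
      calc _ ≤ 2 ^ (n + 3) * domConst n * q * b := by
            gcongr
            · norm_num
            · omega
        _ = _ := by ring
    exact ⟨(norm_heat_time_sub_le ht (by linarith) (by linarith) w).trans hc,
      (bddAE_heat_time_sub ht (by linarith) (by linarith) w).mono (by gcongr)⟩
  · have hq : 1 ≤ 2 * q := by
      have : 1 / 2 ≤ s / t := by rw [div_le_div_iff₀ (by norm_num) ht]; linarith
      linarith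
    have hTb : 2 ^ (n + 2) * b ≤ timeConst n * b * q := by
      calc 2 ^ (n + 2) * b = 2 ^ (n + 2) * b * 1 := by ring
        _ ≤ 2 ^ (n + 2) * b * (2 * q) := by gcongr
        _ = 2 ^ (n + 3) * b * q := by ring
        _ ≤ _ := by gcongr
    refine ⟨?_, ?_⟩
    · refine le_trans ?_ hTb
      calc _ ≤ ‖heat (t - s) w‖ + ‖heat t w‖ := norm_sub_le _ _
        _ ≤ b + b := add_le_add ((norm_heat_le _ _).trans hb) ((norm_heat_le _ _).trans hb)
        _ ≤ _ := by rw [pow_add]; nlinarith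
    · have b1 := bddAE_heat_sub_time hb hs.le hst hw
      have b2 := bddAE_heat_sub_time hb le_rfl ht.le
        (hw.mono (by simpa [rho] using mul_le_of_le_one_right hb0 (rho_le_one (n := n) hs.le)))
      rw [sub_zero] at b2
      refine (b1.sub b2).mono ?_
      calc _ = 2 ^ (n + 2) * b * rho n t := by ring
        _ ≤ 2 ^ (n + 2) * b * t ^ (-((n : ℝ) / 2)) := by gcongr; exact rho_le_rpow ht
        _ ≤ _ := by gcongr

namespace DecayBound

variable {M : ℝ} {u : ℝ → L1 n} {φ : L1 n}

theorem sub_heat_phi1_bounds (hu : DecayBound M u) (h : PowerGrowth f K p)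
    (hd : ∀ t, 0 ≤ t → u t = heat t φ + ∫ s in (0 : ℝ)..t, heat (t - s) (nonlin f (u s)))
    {k : ℕ} (hk : k = 1 ∨ k = 2) (hσ : (k : ℝ) / 2 + 1 < (n : ℝ) / 2 * (p - 1)) :
    ∃ C, 0 ≤ C ∧ ∀ t, 0 < t → ‖u t - heat t (phi1 f φ u)‖ ≤ C / √t ^ k ∧
      BddAE (C / √t ^ k * t ^ (-((n : ℝ) / 2))) (u t - heat t (phi1 f φ u)) := by
  have hK := h.pos
  have hM := hu.nonneg
  have hT : 0 ≤ timeConst n := le_trans (by positivity) (two_pow_le_timeConst n)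
  have hσ' : 1 < (n : ℝ) / 2 * (p - 1) := by
    have : (0 : ℝ) ≤ (k : ℝ) / 2 := by positivity
    linarith
  set L := K * M ^ (p - 1) * M with hL
  have hL0 : 0 ≤ L := by positivity
  have hint := integrableOn_sqrt_pow_mul_rho (n := n) (p := p) hσ
  have hFint := hu.integrableOn_nonlin h hσ'
  refine ⟨timeConst n * L * ∫ s in Ioi (0 : ℝ), √(1 + s) ^ k * rho n s ^ (p - 1), ?_,
    fun t ht => ?_⟩
  · refine mul_nonneg (by positivity) (setIntegral_nonneg measurableSet_Ioi fun s hs => ?_)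
    have := rho_pos (n := n) (le_of_lt hs)
    positivity
  set F := fun s => nonlin f (u s) with hF
  have i1 : IntegrableOn (fun s => heat (t - s) (F s)) (Ioc 0 t) :=
    (intervalIntegrable_iff_integrableOn_Ioc_of_le ht.le).1 (hu.intervalIntegrable h t le_rfl ht.le)
  have i2 : IntegrableOn (fun s => heat t (F s)) (Ioi 0) :=
    (heatCLM n t).integrable_comp hFint
  have i3 : IntegrableOn ((Ioc 0 t).indicator fun s => heat (t - s) (F s)) (Ioi 0) :=
    ((integrable_indicator_iff measurableSet_Ioc).2 i1).integrableOn
  set Q := fun s => (Ioc 0 t).indicator (fun s => heat (t - s) (F s)) s - heat t (F s) with hQ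
  have hE : u t - heat t (phi1 f φ u) = ∫ s in Ioi (0 : ℝ), Q s := by
    have e1 : heat t (∫ s in Ioi (0 : ℝ), F s) = ∫ s in Ioi (0 : ℝ), heat t (F s) :=
      ((heatCLM n t).integral_comp_comm hFint).symm
    rw [hQ, integral_sub i3 i2, setIntegral_indicator measurableSet_Ioc,
      inter_eq_self_of_subset_right Ioc_subset_Ioi_self, phi1, heat_add_map, e1, hd t ht.le,
      intervalIntegral.integral_of_le ht.le]
    abel
  have hst : 0 < √t := Real.sqrt_pos.2 ht
  have ht0 : 0 < t ^ (-((n : ℝ) / 2)) := by positivity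
  set D := timeConst n * L / √t ^ k with hD
  have hD0 : 0 ≤ D := by positivity
  have bounds : ∀ s, 0 < s → ‖Q s‖ ≤ D * (√(1 + s) ^ k * rho n s ^ (p - 1)) ∧
      BddAE (D * (√(1 + s) ^ k * rho n s ^ (p - 1)) * t ^ (-((n : ℝ) / 2))) (Q s) := by
    intro s hs
    have hρ := rho_pos (n := n) hs.le
    have hω : 0 < rho n s ^ (p - 1) := by positivity
    have a1 := hu.norm_nonlin_le h hs.le
    have a2 := hu.bddAE_nonlin h hs.le
    have hsq : √s ^ k ≤ √(1 + s) ^ k := by gcongr; linarith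
    by_cases hs2 : s ≤ t
    · have e : Q s = heat (t - s) (F s) - heat t (F s) := by
        simp only [hQ]
        rw [indicator_of_mem (show s ∈ Ioc 0 t from ⟨hs, hs2⟩)]
      obtain ⟨b1, b2⟩ := heat_time_sub_bounds hk a1 hs hs2 a2
      have hc : timeConst n * (L * rho n s ^ (p - 1)) * (√s ^ k / √t ^ k) ≤
          D * (√(1 + s) ^ k * rho n s ^ (p - 1)) := by
        calc _ = D * (√s ^ k * rho n s ^ (p - 1)) := by rw [hD]; ring
          _ ≤ _ := by gcongr
      rw [e]
      exact ⟨b1.trans hc, b2.mono (by gcongr)⟩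
    · have hs2 : t < s := not_le.1 hs2
      have e : Q s = - heat t (F s) := by
        simp only [hQ]
        rw [indicator_of_notMem (fun hm : s ∈ Ioc 0 t => hs2.not_ge hm.2), zero_sub]
      have hq : 1 ≤ √(1 + s) ^ k / √t ^ k := by
        rw [one_le_div (by positivity)]; gcongr; linarith
      have hT2 : 2 ^ (n + 1) ≤ timeConst n :=
        le_trans (pow_le_pow_right₀ (by norm_num) (by omega)) (two_pow_le_timeConst n)
      have hc : 2 ^ (n + 1) * (L * rho n s ^ (p - 1)) ≤
          D * (√(1 + s) ^ k * rho n s ^ (p - 1)) := by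
        calc _ ≤ timeConst n * (L * rho n s ^ (p - 1)) * (√(1 + s) ^ k / √t ^ k) := by
              refine le_trans ?_ (le_mul_of_one_le_right (by positivity) hq)
              gcongr
          _ = _ := by rw [hD]; ring
      have b2 := bddAE_heat_sub_time a1 le_rfl ht.le
        (a2.mono (d := L * rho n s ^ (p - 1) * rho n 0) (by
          simpa [rho] using mul_le_of_le_one_right
            (by positivity : 0 ≤ L * rho n s ^ (p - 1)) (rho_le_one (n := n) hs.le)))
      rw [sub_zero] at b2
      rw [e, norm_neg]
      refine ⟨((norm_heat_le _ _).trans a1).trans (le_trans ?_ hc), (b2.mono ?_).neg⟩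
      · exact le_mul_of_one_le_left (by positivity) (one_le_pow₀ (by norm_num))
      · have := rho_le_rpow (n := n) ht
        have hρt := rho_pos (n := n) ht.le
        gcongr
  have hval : ∫ s in Ioi (0 : ℝ), D * (√(1 + s) ^ k * rho n s ^ (p - 1)) =
      (timeConst n * L * ∫ s in Ioi (0 : ℝ), √(1 + s) ^ k * rho n s ^ (p - 1)) / √t ^ k := by
    rw [integral_const_mul, hD]; ring
  rw [hE]
  constructor
  · rw [← hval]
    exact norm_integral_le_of_norm_le (hint.const_mul D)
      ((ae_restrict_mem measurableSet_Ioi).mono fun s hs => (bounds s hs).1)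
  · rw [← hval, ← integral_mul_const]
    exact BddAE.integral (i3.sub i2) ((hint.const_mul D).mul_const _)
      ((ae_restrict_mem measurableSet_Ioi).mono fun s hs => (bounds s hs).2)

end DecayBound

theorem dilation_gaussKernel {t : ℝ} (ht : 0 < t) (x : Rn n) :
    dilation t (gaussKernel n 1) x = gaussKernel n t x := by
  have e1 : (t ^ (-(1 / 2) : ℝ)) ^ 2 = t⁻¹ := by
    rw [← Real.rpow_natCast, ← Real.rpow_mul ht.le, ← Real.rpow_neg_one]; norm_num
  simp only [dilation, gaussKernel]
  rw [← mul_assoc, ← Real.mul_rpow ht.le (by positivity), norm_smul, mul_pow,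
    Real.norm_of_nonneg (by positivity), e1]
  congr 2
  · ring
  · field_simp

theorem profile0_eq {t : ℝ} (ht : 0 < t) (ψ : Rn n → ℝ) (x : Rn n) :
    profile0 ψ t x = ∫ y, gaussKernel n t x * ψ y := by
  rw [profile0, moment0, dilation_gaussKernel ht, integral_const_mul, mul_comm]

theorem inner_mul_gaussKernel_mul_eq_sum (t : ℝ) (ψ : Rn n → ℝ) (x y : Rn n) :
    inner ℝ x y / (2 * t) * gaussKernel n t x * ψ y =
      ∑ j, (gaussKernel n t x / (2 * t) * x j) * (y j * ψ y) := by
  have : inner ℝ x y = ∑ j, x j * y j := by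
    rw [PiLp.inner_apply]
    exact Finset.sum_congr rfl fun j _ => by simp [mul_comm]
  rw [this, Finset.sum_div, Finset.sum_mul, Finset.sum_mul]
  exact Finset.sum_congr rfl fun j _ => by ring

theorem profile1_eq {t : ℝ} (ht : 0 < t) {ψ : Rn n → ℝ}
    (hj : ∀ j, Integrable fun y : Rn n => y j * ψ y) (x : Rn n) :
    profile1 ψ t x = profile0 ψ t x + ∫ y, inner ℝ x y / (2 * t) * gaussKernel n t x * ψ y := by
  have e1 : t ^ (-(1 / 2) : ℝ) * t ^ (-(1 / 2) : ℝ) = t⁻¹ := by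
    rw [← Real.rpow_add ht, ← Real.rpow_neg_one]; norm_num
  have e2 : ∀ j, dilation t (fun z : Rn n => z j * gaussKernel n 1 z) x =
      t ^ (-(1 / 2) : ℝ) * x j * gaussKernel n t x := by
    intro j
    rw [← dilation_gaussKernel ht]
    simp only [dilation, PiLp.smul_apply, smul_eq_mul]
    ring
  rw [profile1]
  congr 1
  simp only [inner_mul_gaussKernel_mul_eq_sum]
  rw [integral_finsetSum _ fun j _ => (hj j).const_mul _, Finset.mul_sum]
  refine Finset.sum_congr rfl fun j _ => ?_
  rw [e2, integral_const_mul, moment1]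
  calc _ = (t ^ (-(1 / 2) : ℝ) * t ^ (-(1 / 2) : ℝ)) / 2 * gaussKernel n t x * x j *
        ∫ y : Rn n, y j * ψ y := by ring
    _ = _ := by rw [e1]; ring

theorem integrable_coord_mul {k : ℕ} (hk : k = 1 ∨ k = 2) {ψ : Rn n → ℝ} (hψ : Integrable ψ)
    (h : Integrable fun y => ‖y‖ ^ k * |ψ y|) (j : Fin n) :
    Integrable fun y : Rn n => y j * ψ y := by
  have hc : Continuous fun y : Rn n => y j := by fun_prop
  refine (hψ.abs.add h).mono' (hc.aestronglyMeasurable.mul hψ.1) (ae_of_all _ fun y => ?_)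
  rw [norm_mul, Real.norm_eq_abs (ψ y)]
  simp only [Pi.add_apply]
  have h1 : ‖y j‖ ≤ ‖y‖ := PiLp.norm_apply_le y j
  have h2 : ‖y‖ ≤ 1 + ‖y‖ ^ k := by
    rcases hk with rfl | rfl
    · simp
    · nlinarith [sq_nonneg (‖y‖ - 1)]
  calc _ ≤ (1 + ‖y‖ ^ k) * |ψ y| := by gcongr; linarith
    _ = _ := by ring

theorem abs_integral_kernel_le {t : ℝ} (ht : 0 < t) {k : ℕ} {ψ : Rn n → ℝ}
    (h : Integrable fun y => ‖y‖ ^ k * |ψ y|) {x : Rn n} {R : Rn n → ℝ}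
    (hR : ∀ y, |R y| ≤ 3 * domConst n * (‖y‖ ^ k / √t ^ k) *
      (gaussKernel n (2 * t) (x - y) + gaussKernel n (2 * t) x)) :
    |∫ y, R y * ψ y| ≤ 3 * domConst n / √t ^ k *
      (gaussConv (2 * t) (fun y => ‖y‖ ^ k * |ψ y|) x +
        (∫ y, ‖y‖ ^ k * |ψ y|) * gaussKernel n (2 * t) x) := by
  have h2t : 0 < 2 * t := by positivity
  have i1 := integrable_gaussKernel_mul h2t h x
  rw [gaussConv, ← integral_mul_const, ← integral_add i1 (h.mul_const _), ← integral_const_mul,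
    ← Real.norm_eq_abs]
  refine norm_integral_le_of_norm_le ((i1.add (h.mul_const _)).const_mul _)
    (ae_of_all _ fun y => ?_)
  rw [norm_mul, Real.norm_eq_abs, Real.norm_eq_abs]
  calc _ ≤ 3 * domConst n * (‖y‖ ^ k / √t ^ k) *
      (gaussKernel n (2 * t) (x - y) + gaussKernel n (2 * t) x) * |ψ y| := by gcongr; exact hR y
    _ = _ := by ring

theorem abs_gaussConv_sub_profile0_le {t : ℝ} (ht : 0 < t) {ψ : Rn n → ℝ} (hψ : Integrable ψ)
    (h : Integrable fun y => ‖y‖ ^ 1 * |ψ y|) (x : Rn n) :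
    |gaussConv t ψ x - profile0 ψ t x| ≤ 3 * domConst n / √t ^ 1 *
      (gaussConv (2 * t) (fun y => ‖y‖ ^ 1 * |ψ y|) x +
        (∫ y, ‖y‖ ^ 1 * |ψ y|) * gaussKernel n (2 * t) x) := by
  have e : gaussConv t ψ x - profile0 ψ t x =
      ∫ y, (gaussKernel n t (x - y) - gaussKernel n t x) * ψ y := by
    simp only [sub_mul]
    rw [profile0_eq ht, gaussConv,
      integral_sub (integrable_gaussKernel_mul ht hψ x) (hψ.const_mul _)]
  rw [e]
  refine abs_integral_kernel_le ht h fun y => ?_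
  rw [pow_one, pow_one]
  exact abs_gaussKernel_sub_taylor_zero_le ht x y

theorem abs_gaussConv_sub_profile1_le {t : ℝ} (ht : 0 < t) {ψ : Rn n → ℝ} (hψ : Integrable ψ)
    (h : Integrable fun y => ‖y‖ ^ 2 * |ψ y|) (x : Rn n) :
    |gaussConv t ψ x - profile1 ψ t x| ≤ 3 * domConst n / √t ^ 2 *
      (gaussConv (2 * t) (fun y => ‖y‖ ^ 2 * |ψ y|) x +
        (∫ y, ‖y‖ ^ 2 * |ψ y|) * gaussKernel n (2 * t) x) := by
  have hj := integrable_coord_mul (Or.inr rfl) hψ h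
  have i3 : Integrable fun y => inner ℝ x y / (2 * t) * gaussKernel n t x * ψ y := by
    have : Integrable fun y : Rn n => ∑ j, (gaussKernel n t x / (2 * t) * x j) * (y j * ψ y) :=
      integrable_finsetSum _ fun j _ => (hj j).const_mul _
    exact this.congr (ae_of_all _ fun y => (inner_mul_gaussKernel_mul_eq_sum t ψ x y).symm)
  have e : gaussConv t ψ x - profile1 ψ t x =
      ∫ y, (gaussKernel n t (x - y) - gaussKernel n t x -
        inner ℝ x y / (2 * t) * gaussKernel n t x) * ψ y := by
    simp only [sub_mul]
    rw [profile1_eq ht hj, profile0_eq ht, gaussConv, integral_sub _ i3,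
      integral_sub (integrable_gaussKernel_mul ht hψ x) (hψ.const_mul _), sub_sub]
    exact (integrable_gaussKernel_mul ht hψ x).sub (hψ.const_mul _)
  rw [e]
  refine abs_integral_kernel_le ht h fun y => ?_
  rw [Real.sq_sqrt ht.le]
  refine (abs_gaussKernel_sub_taylor_one_le ht x y).trans ?_
  have hD := one_le_domConst n
  have g1 := gaussKernel_nonneg (n := n) (t := 2 * t) (by positivity) (x - y)
  have g2 := gaussKernel_nonneg (n := n) (t := 2 * t) (by positivity) x
  gcongr
  norm_num

/-- Decay of a function dominated by a decaying `L¹` function and Gaussian averages. -/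
theorem eLpNorm_le_of_gauss_dominated {g : Rn n → ℝ} {E : L1 n} {h : Rn n → ℝ} {t a D : ℝ}
    (ht : 0 < t) (hD : 0 ≤ D) (hE1 : ‖E‖ ≤ a)
    (hE2 : BddAE (a * t ^ (-((n : ℝ) / 2))) E) (hh : Integrable h) (h0 : ∀ y, 0 ≤ h y)
    (hg : ∀ᵐ x, |g x| ≤ |E x| + D * (gaussConv (2 * t) h x +
      (∫ y, h y) * gaussKernel n (2 * t) x)) {A : ℝ} (hA : 0 < A)
    (hAle : a + 2 * D * ∫ y, h y ≤ A) {q : ℝ≥0∞} (hq : 1 ≤ q) :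
    ENNReal.ofReal (t ^ decayExp n q) * eLpNorm g q volume ≤ ENNReal.ofReal A := by
  have h2t : 0 < 2 * t := by positivity
  have hI : 0 ≤ ∫ y, h y := integral_nonneg h0
  have i1 := integrable_gaussConv h2t hh
  have i2 : Integrable fun x : Rn n => (∫ y, h y) * gaussKernel n (2 * t) x :=
    (integrable_gaussKernel n h2t).const_mul _
  have i12 : Integrable fun x : Rn n =>
      gaussConv (2 * t) h x + (∫ y, h y) * gaussKernel n (2 * t) x := i1.add i2
  have iE := (L1.integrable_coeFn E).abs
  refine eLpNorm_interpolation hA ht ?_ ?_ hq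
  · have iG : Integrable fun x => |E x| + D * (gaussConv (2 * t) h x +
        (∫ y, h y) * gaussKernel n (2 * t) x) := iE.add (i12.const_mul D)
    refine (eLpNorm_mono_ae_real hg).trans ?_
    rw [eLpNorm_one_eq_lintegral_enorm, ← ofReal_integral_norm_eq_lintegral_enorm iG]
    refine ENNReal.ofReal_le_ofReal (le_trans ?_ hAle)
    have e : ∫ x, ‖|E x| + D * (gaussConv (2 * t) h x +
        (∫ y, h y) * gaussKernel n (2 * t) x)‖ = ‖E‖ + D * ((∫ y, h y) + ∫ y, h y) := by
      rw [integral_congr_ae (g := fun x => |E x| + D * (gaussConv (2 * t) h x +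
        (∫ y, h y) * gaussKernel n (2 * t) x)) (ae_of_all _ fun x => ?_)]
      · rw [integral_add iE (i12.const_mul D), integral_const_mul, integral_add i1 i2,
          integral_gaussConv h2t hh, integral_const_mul, integral_gaussKernel h2t, mul_one,
          L1.norm_eq_integral_norm]
        rfl
      · refine Real.norm_of_nonneg ?_
        have := gaussConv_nonneg h2t h0 x
        have := gaussKernel_nonneg h2t x
        positivity
    rw [e]; linarith
  · rw [eLpNorm_exponent_top]
    refine eLpNormEssSup_le_of_ae_bound (C := A * t ^ (-((n : ℝ) / 2))) ?_
    filter_upwards [hg, hE2] with x h1 h2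
    have ht0 : 0 < t ^ (-((n : ℝ) / 2)) := by positivity
    have b1 := (gaussConv_le h2t hh h0 x).trans
      (mul_le_mul_of_nonneg_right (rpow_gauss_le (n := n) ht) hI)
    have b2 := mul_le_mul_of_nonneg_left ((gaussKernel_le h2t x).trans (rpow_gauss_le ht)) hI
    calc _ ≤ _ := h1
      _ ≤ a * t ^ (-((n : ℝ) / 2)) + D * (t ^ (-((n : ℝ) / 2)) * (∫ y, h y) +
          (∫ y, h y) * t ^ (-((n : ℝ) / 2))) := by gcongr
      _ = (a + 2 * D * ∫ y, h y) * t ^ (-((n : ℝ) / 2)) := by ring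
      _ ≤ _ := by gcongr

/-- Convergence to a profile that approximates the heat flow of `φ₁`. -/
theorem DecayBound.profile_decay {M : ℝ} {u : ℝ → L1 n} {φ : L1 n} (hu : DecayBound M u)
    (h : PowerGrowth f K p)
    (hd : ∀ t, 0 ≤ t → u t = heat t φ + ∫ s in (0 : ℝ)..t, heat (t - s) (nonlin f (u s)))
    {k : ℕ} (hk : k = 1 ∨ k = 2) (hσ : (k : ℝ) / 2 + 1 < (n : ℝ) / 2 * (p - 1))
    (hφ : Integrable fun x => ‖x‖ ^ k * |phi1 f φ u x|) {P : ℝ → Rn n → ℝ}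
    (hP : ∀ t, 0 < t → ∀ x, |gaussConv t (phi1 f φ u) x - P t x| ≤ 3 * domConst n / √t ^ k *
      (gaussConv (2 * t) (fun y => ‖y‖ ^ k * |phi1 f φ u y|) x +
        (∫ y, ‖y‖ ^ k * |phi1 f φ u y|) * gaussKernel n (2 * t) x)) :
    ∃ C, 0 < C ∧ ∀ t, 0 < t → ∀ q : ℝ≥0∞, 1 ≤ q →
      ENNReal.ofReal (t ^ decayExp n q) * eLpNorm (fun x => u t x - P t x) q volume ≤
        ENNReal.ofReal (C / √t ^ k) := by
  obtain ⟨C, hC, hCt⟩ := hu.sub_heat_phi1_bounds h hd hk hσ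
  have hD := one_le_domConst n
  set I := ∫ y, ‖y‖ ^ k * |phi1 f φ u y| with hI
  have hI0 : 0 ≤ I := integral_nonneg fun y => by positivity
  refine ⟨C + 6 * domConst n * I + 1, by positivity, fun t ht q hq => ?_⟩
  have hst : 0 < √t := Real.sqrt_pos.2 ht
  obtain ⟨h1, h2⟩ := hCt t ht
  refine eLpNorm_le_of_gauss_dominated ht (D := 3 * domConst n / √t ^ k) (by positivity) h1 h2 hφ
    (fun y => by positivity) ?_ (by positivity) ?_ hq
  · filter_upwards [Lp.coeFn_sub (u t) (heat t (phi1 f φ u)), coeFn_heat ht (phi1 f φ u)]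
      with x e1 e2
    rw [e1, Pi.sub_apply, e2]
    calc |u t x - P t x| = |(u t x - gaussConv t (phi1 f φ u) x) +
          (gaussConv t (phi1 f φ u) x - P t x)| := by congr 1; ring
      _ ≤ _ := abs_add_le _ _
      _ ≤ _ := by gcongr; exact hP t ht x
  · rw [← hI]
    calc C / √t ^ k + 2 * (3 * domConst n / √t ^ k) * I = (C + 6 * domConst n * I) / √t ^ k := by
          ring
      _ ≤ (C + 6 * domConst n * I + 1) / √t ^ k := by
          rw [div_le_div_iff_of_pos_right (by positivity)]; linarith

end SemilinearHeat

theorem theorem1p4 (n : ℕ) (hn : 0 < n) (p : ℝ) (hp : 1 + 2 / (n : ℝ) < p)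
    (f : ℝ → ℝ) (K : ℝ) (hK : 0 < K)
    (hf : ∀ ξ η : ℝ, |f ξ - f η| ≤ K * (|ξ| ^ (p - 1) + |η| ^ (p - 1)) * |ξ - η|)
    (hf0 : f 0 = 0) :
    ∃ ε₀ : ℝ, 0 < ε₀ ∧
      -- existence, uniqueness and decay of the global solution for small data
      (∀ φ : SemilinearHeat.L1 n, MemLp φ ∞ volume →
        eLpNorm φ 1 volume + eLpNorm φ ∞ volume ≤ ENNReal.ofReal ε₀ →
        ∃ u : ℝ → SemilinearHeat.L1 n,
          SemilinearHeat.IsGlobalSolution f φ u ∧ SemilinearHeat.HasDecay u ∧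
          ∀ v : ℝ → SemilinearHeat.L1 n, SemilinearHeat.IsGlobalSolution f φ v →
            ∀ t : ℝ, 0 ≤ t → v t = u t) ∧
      -- its asymptotic profiles
      (∀ m : ℕ, (m = 0 ∨ m = 1) → 1 + (3 + (m : ℝ)) / (n : ℝ) < p →
        ∀ φ : SemilinearHeat.L1 n,
          SemilinearHeat.MemWeightedL1 (m + 1) φ → MemLp φ ∞ volume →
          eLpNorm φ 1 volume + eLpNorm φ ∞ volume ≤ ENNReal.ofReal ε₀ →
          ∀ u : ℝ → SemilinearHeat.L1 n, SemilinearHeat.IsGlobalSolution f φ u →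
            -- `φ₁` and its first moments are well defined
            IntegrableOn (fun s => SemilinearHeat.nonlin f (u s)) (Ioi (0 : ℝ)) volume ∧
            (∀ j : Fin n, Integrable
              (fun y : SemilinearHeat.Rn n => y j * SemilinearHeat.phi1 f φ u y) volume) ∧
            ∀ q : ℝ≥0∞, 1 ≤ q → ∃ C : ℝ, 0 < C ∧ ∀ t : ℝ, 1 < t →
              (m = 0 →
                ENNReal.ofReal (t ^ SemilinearHeat.decayExp n q) *
                  eLpNorm (fun x => u t x -
                    SemilinearHeat.profile0 (SemilinearHeat.phi1 f φ u) t x) q volume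
                ≤ ENNReal.ofReal (C * t ^ (-(1 / 2) : ℝ))) ∧
              (m = 1 →
                ENNReal.ofReal (t ^ SemilinearHeat.decayExp n q) *
                  eLpNorm (fun x => u t x -
                    SemilinearHeat.profile1 (SemilinearHeat.phi1 f φ u) t x) q volume
                ≤ ENNReal.ofReal (C * t ^ (-1 : ℝ)))) := by
  have hn' : (0 : ℝ) < n := by exact_mod_cast hn
  have hp1 : 1 < p := by
    have : 0 < 2 / (n : ℝ) := by positivity
    linarith
  have hG : SemilinearHeat.PowerGrowth f K p := ⟨hp1, hK, hf, hf0⟩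
  have hexp : ∀ c : ℝ, 1 + c / (n : ℝ) < p → c / 2 < (n : ℝ) / 2 * (p - 1) := by
    intro c hc
    have h1 : c / (n : ℝ) < p - 1 := by linarith
    rw [div_lt_iff₀ hn'] at h1
    linarith
  have hσ : 1 < (n : ℝ) / 2 * (p - 1) := by simpa using hexp 2 hp
  obtain ⟨M, hM⟩ := SemilinearHeat.exists_smallRadius n hK hp1
  have hM0 := hM.pos
  have hε : 0 < M / 2 ^ (n + 2) := by positivity
  have hex : ∀ φ : SemilinearHeat.L1 n,
      eLpNorm φ 1 volume + eLpNorm φ ∞ volume ≤ ENNReal.ofReal (M / 2 ^ (n + 2)) →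
      ∃ u : ℝ → SemilinearHeat.L1 n, SemilinearHeat.DecayBound M u ∧ ∀ t, 0 ≤ t →
        u t = SemilinearHeat.heat t φ + ∫ s in (0 : ℝ)..t,
          SemilinearHeat.heat (t - s) (SemilinearHeat.nonlin f (u s)) := by
    intro φ hφ
    refine SemilinearHeat.exists_decay_solution hG hσ hM ?_
      (SemilinearHeat.bddAE_of_eLpNorm_top_le hε.le (le_add_self.trans hφ))
    rw [Lp.norm_def]
    exact ENNReal.toReal_le_of_le_ofReal hε.le (le_self_add.trans hφ)
  refine ⟨M / 2 ^ (n + 2), hε, fun φ _ hφ => ?_, fun m hm hpm φ hφw _ hφ v hv => ?_⟩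
  · obtain ⟨u, hu, hd⟩ := hex φ hφ
    have hsol := hu.isGlobalSolution hG hd
    exact ⟨u, hsol, hu.hasDecay hM0, fun v hv t ht => hv.unique hG hsol ht⟩
  · obtain ⟨u, hu, hd⟩ := hex φ hφ
    have huv : ∀ t, 0 ≤ t → u t = v t := fun t ht => (hu.isGlobalSolution hG hd).unique hG hv ht
    have hv' : SemilinearHeat.DecayBound M v :=
      ⟨hM0.le, hv.memX.continuousOn_L1, fun t ht => huv t ht ▸ hu.norm_le t ht,
        fun t ht => huv t ht ▸ hu.bdd t ht⟩
    have hk : m + 1 = 1 ∨ m + 1 = 2 := by omega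
    have hσm : ((m + 1 : ℕ) : ℝ) / 2 + 1 < (n : ℝ) / 2 * (p - 1) := by
      have := hexp _ hpm
      push_cast
      linarith
    have hmom := hv'.integrable_norm_pow_mul_phi1 hG hM hv.duhamel hk hσm
      (hφw.integrable_norm_pow_mul hk)
    have hψ := L1.integrable_coeFn (SemilinearHeat.phi1 f φ v)
    refine ⟨hv'.integrableOn_nonlin hG hσ,
      SemilinearHeat.integrable_coord_mul hk hψ hmom, fun q hq => ?_⟩
    rcases hm with rfl | rfl
    · obtain ⟨C, hC, hCt⟩ := hv'.profile_decay hG hv.duhamel hk hσm hmom fun t ht x =>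
        SemilinearHeat.abs_gaussConv_sub_profile0_le ht hψ hmom x
      refine ⟨C, hC, fun t ht => ⟨fun _ => ?_, fun h => absurd h (by norm_num)⟩⟩
      have ht0 : 0 < t := by linarith
      have e : C * t ^ (-(1 / 2) : ℝ) = C / √t ^ (0 + 1) := by
        rw [zero_add, pow_one, Real.sqrt_eq_rpow, Real.rpow_neg ht0.le]
        exact (div_eq_mul_inv _ _).symm
      rw [e]
      exact hCt t ht0 q hq
    · obtain ⟨C, hC, hCt⟩ := hv'.profile_decay hG hv.duhamel hk hσm hmom fun t ht x =>
        SemilinearHeat.abs_gaussConv_sub_profile1_le ht hψ hmom x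
      refine ⟨C, hC, fun t ht => ⟨fun h => absurd h (by norm_num), fun _ => ?_⟩⟩
      have ht0 : 0 < t := by linarith
      have e : C * t ^ (-1 : ℝ) = C / √t ^ (1 + 1) := by
        rw [Real.rpow_neg_one, Real.sq_sqrt ht0.le, div_eq_mul_inv]
      rw [e]
      exact hCt t ht0 q hq
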